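/- Let $d\ge 1$ and let $\kappa$ be a probability density function on $\mathbb{R}^d$ that is bounded and Lebesgue-almost everywhere continuous. Let $\mathcal M$ be the space of compact subsets of $\mathbb{R}^d$ with the Borel $\sigma$-algebra of the Hausdorff distance, let $T$ be a random element of $\mathcal M$ with distribution $\mu_{\mathcal M}$, and write $\|t\|$ for the Lebesgue measure of $t\in\mathcal M$. For $\lambda>0$ let $\mathcal P_\lambda$ be a Poisson point process in $\mathbb{R}^d\times\mathcal M$ with intensity measure $\lambda\,(\kappa(x)\,dx\times\mu_{\mathcal M})$, and for $n\in\mathbb N$ let $\mathcal X_n$ be the point process consisting of $n$ independent random elements of $\mathbb{R}^d\times\mathcal M$ with common distribution $\kappa(x)\,dx\times\mu_{\mathcal M}$. For finite $\mathcal X\subset\mathbb{R}^d\times\mathcal M$ and $\lambda>0$ put $$\Xi_\lambda(\mathcal X)=\bigcup_{(x,t)\in\mathcal X}\bigl(x+\lambda^{-1/d}t\bigr).$$ Suppose that for $q=1$ or $q=2$, and for some $p>q$, we have $\mathbb E[\|T\|^p]<\infty$, and let $f:\mathbb{R}^d\to\mathbb{R}$ be bounded and Borel measurable. Then there is a (finite,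 non-random) constant $c\in\mathbb{R}$ such that, as $\lambda\to\infty$, $$\int_{\Xi_\lambda(\mathcal P_\lambda)} f(x)\,dx\longrightarrow c\quad\text{in }L^q,$$ and such that, whenever $(\lambda(n))_{n\ge1}$ is a sequence of real numbers with $\lambda(n)/n\to1$ as $n\to\infty$, $$\int_{\Xi_{\lambda(n)}(\mathcal X_n)} f(x)\,dx\longrightarrow c\quad\text{in }L^q .$$ -/

import Mathlib

open MeasureTheory ProbabilityTheory Filter Topology TopologicalSpace
open scoped ENNReal NNReal

/-- The space of compact subsets of a topological space carries the Borel σ-algebra of Mathlib's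
topology on `Compacts` (Vietoris topology; for metric spaces, the topology of the Hausdorff
distance, with the empty set isolated). -/
instance compactsMeasurableSpace (α : Type*) [TopologicalSpace α] :
    MeasurableSpace (Compacts α) :=
  borel (Compacts α)

instance compactsBorelSpace (α : Type*) [TopologicalSpace α] : BorelSpace (Compacts α) :=
  ⟨rfl⟩

namespace GermGrain

/-- `κ` is a probability density function on `ℝ^d` which is bounded and Lebesgue-almost everywhere
continuous. -/
structure IsAdmissibleDensity {d : ℕ} (κ : EuclideanSpace ℝ (Fin d) → ℝ) : Prop where
  measurable : Measurable κ
  nonneg : ∀ x, 0 ≤ κ x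
  lintegral_eq_one : ∫⁻ x, ENNReal.ofReal (κ x) = 1
  bounded : ∃ C : ℝ, ∀ x, κ x ≤ C
  ae_continuous : ∀ᵐ x, ContinuousAt κ x

/-- The probability distribution on `ℝ^d` with density `κ` with respect to Lebesgue measure. -/
noncomputable def densityMeasure {d : ℕ} (κ : EuclideanSpace ℝ (Fin d) → ℝ) :
    Measure (EuclideanSpace ℝ (Fin d)) :=
  volume.withDensity fun x => ENNReal.ofReal (κ x)

/-- The random set `N` of points of `S`, defined on the probability space `(Ω, Pr)`, is a Poisson
point process with intensity measure `Λ`: the numbers of points in measurable sets are random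
variables, they are Poisson distributed with mean `Λ B` whenever `Λ B` is finite, and they are
independent for pairwise disjoint sets. -/
structure IsPoissonProcess {Ω S : Type*} [MeasurableSpace Ω] [MeasurableSpace S]
    (N : Ω → Set S) (Λ : Measure S) (Pr : Measure Ω) : Prop where
  measurable_count : ∀ B : Set S, MeasurableSet B → Measurable fun ω => (N ω ∩ B).encard
  law_count : ∀ B : Set S, MeasurableSet B → Λ B ≠ ∞ →
    Pr.map (fun ω => (N ω ∩ B).encard)
      = (poissonMeasure (Λ B).toNNReal).map (Nat.cast : ℕ → ℕ∞)
  indep_count : ∀ (k : ℕ) (B : Fin k → Set S), (∀ i, MeasurableSet (B i)) →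
    Pairwise (fun i j => Disjoint (B i) (B j)) →
    iIndepFun (fun i ω => (N ω ∩ B i).encard) Pr

/-- The random set `N` of points of `S`, defined on the probability space `(Ω, Pr)`, is a binomial
point process: it consists of `n` independent random elements of `S` with common
distribution `Q`. -/
def IsBinomialProcess {Ω S : Type*} [MeasurableSpace Ω] [MeasurableSpace S]
    (N : Ω → Set S) (n : ℕ) (Q : Measure S) (Pr : Measure Ω) : Prop :=
  ∃ Y : Fin n → Ω → S, (∀ i, Measurable (Y i)) ∧ (∀ i, Pr.map (Y i) = Q) ∧
    iIndepFun Y Pr ∧ ∀ ω, N ω = Set.range fun i => Y i ω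

/-- The germ-grain set `Ξ_l(X) = ⋃_{(x, t) ∈ X} (x + l ^ (-1/d) t)` in `ℝ^d`. -/
noncomputable def grainUnion {d : ℕ} (l : ℝ)
    (X : Set (EuclideanSpace ℝ (Fin d) × Compacts (EuclideanSpace ℝ (Fin d)))) :
    Set (EuclideanSpace ℝ (Fin d)) :=
  ⋃ z ∈ X, (fun u => z.1 + (l ^ (-(1 : ℝ) / (d : ℝ))) • u) ''
    (z.2 : Set (EuclideanSpace ℝ (Fin d)))

/-- The real random variables `F i` converge in `L^q` to the constant `c` along the filter `l`:
eventually `F i` belongs to `L^q`, and the `L^q` norm of `F i - c` tends to zero. -/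
def ConvergesInLq {Ω ι : Type*} [MeasurableSpace Ω] (F : ι → Ω → ℝ) (l : Filter ι) (c : ℝ)
    (q : ℝ≥0∞) (Pr : Measure Ω) : Prop :=
  (∀ᶠ i in l, MemLp (F i) q Pr) ∧
    Tendsto (fun i => eLpNorm (fun ω => F i ω - c) q Pr) l (𝓝 0)

end GermGrain

/-!
By Fubini, the mean and the variance of the integral over the covered set are integrals of the
probabilities that one or two given points are covered. These are governed by the probability that
no point of the process falls into a set of mass `b`, which is `exp (-M b)` for a Poisson process of
intensity `M` and `(1 - b) ^ M` for `M` independent points.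

If the grains are scaled by `s`, with `M s ^ d → 1`, the expected number of grains covering `x` is
`M s ^ d 𝔼 ∫ u in T, κ (x - s u)`, which converges to `κ x 𝔼‖T‖` in `L¹` because translations are
continuous in `L¹`. So the means converge to `∫ x, f x (1 - exp (-κ x 𝔼‖T‖))`. The covariance of the
events that `x` and `y` are covered is at most `M` times the probability that a single grain covers
both, plus `M` times the product of the probabilities that it covers each of them; integrated over
`x` and `y` this is `M (s ^ (2 d) 𝔼‖T‖² + (s ^ d 𝔼‖T‖)²)`, which tends to zero. This settles
`q = 2`. For `q = 1`, discarding the grains with `‖T‖ > K` costs at most a multiple of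
`𝔼 [‖T‖; ‖T‖ > K]` in `L¹`, and the remaining grains have a finite second moment.
-/

namespace GermGrain

section RandomSet

variable {Ω E : Type*}

/-- The integral of `f` over the random set whose realisations are the sections of `G`. -/
noncomputable def sectionIntegral [MeasurableSpace E] (ν : Measure E) (f : E → ℝ)
    (G : Set (Ω × E)) (ω : Ω) : ℝ :=
  ∫ x in {x | (ω, x) ∈ G}, f x ∂ν

/-- The probability that the random set with sections of `G` as realisations contains `x`. -/
noncomputable def coverProb [MeasurableSpace Ω] (Pr : Measure Ω) (G : Set (Ω × E)) (x : E) : ℝ :=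
  Pr.real {ω | (ω, x) ∈ G}

/-- The set whose sections are the products `Z ×ˢ Z` of the sections `Z` of `G` with
themselves. -/
def sectionSquare (G : Set (Ω × E)) : Set (Ω × (E × E)) :=
  {p | (p.1, p.2.1) ∈ G ∧ (p.1, p.2.2) ∈ G}

/-- The covariance of the events that the random set with sections of `G` as realisations contains
the first and the second component of a given pair of points. -/
noncomputable def coverCov [MeasurableSpace Ω] (Pr : Measure Ω) (G : Set (Ω × E))
    (p : E × E) : ℝ :=
  coverProb Pr (sectionSquare G) p - coverProb Pr G p.1 * coverProb Pr G p.2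

lemma sectionIntegral_sectionSquare [MeasurableSpace E] {ν : Measure E} [SFinite ν] {f : E → ℝ}
    {G : Set (Ω × E)} (ω : Ω) :
    sectionIntegral (ν.prod ν) (fun p => f p.1 * f p.2) (sectionSquare G) ω
      = sectionIntegral ν f G ω ^ 2 := by
  rw [sq]
  exact setIntegral_prod_mul f f {x | (ω, x) ∈ G} {x | (ω, x) ∈ G}

lemma nnnorm_mul_le_mul_self {f : E → ℝ} {C : ℝ≥0} (hC : ∀ x, ‖f x‖₊ ≤ C) (p : E × E) :
    ‖f p.1 * f p.2‖₊ ≤ C * C :=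
  (nnnorm_mul_le _ _).trans (mul_le_mul' (hC _) (hC _))

lemma enorm_coverProb [MeasurableSpace Ω] {Pr : Measure Ω} [IsFiniteMeasure Pr]
    {G : Set (Ω × E)} (x : E) : ‖coverProb Pr G x‖ₑ = Pr {ω | (ω, x) ∈ G} :=
  (Real.enorm_of_nonneg measureReal_nonneg).trans ofReal_measureReal

variable [MeasurableSpace Ω] [MeasurableSpace E] {Pr : Measure Ω} {ν : Measure E}
  {G G' : Set (Ω × E)} {f : E → ℝ} {C : ℝ≥0}

lemma measurableSet_sectionSquare (hG : MeasurableSet G) : MeasurableSet (sectionSquare G) := by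
  have hfst : Measurable fun p : Ω × (E × E) => (p.1, p.2.1) := by fun_prop
  have hsnd : Measurable fun p : Ω × (E × E) => (p.1, p.2.2) := by fun_prop
  exact (hfst hG).inter (hsnd hG)

lemma integrableOn_of_nnnorm_le {X : Type*} [MeasurableSpace X] {μ : Measure X} {g : X → ℝ}
    (hg : Measurable g) (hC : ∀ x, ‖g x‖₊ ≤ C) {s : Set X} (hs : μ s ≠ ∞) : IntegrableOn g s μ :=
  Measure.integrableOn_of_bounded hs hg.aestronglyMeasurable (ae_of_all _ hC)

lemma sectionIntegral_eq_integral_indicator (hG : MeasurableSet G) (ω : Ω) :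
    sectionIntegral ν f G ω = ∫ x, G.indicator (fun p => f p.2) (ω, x) ∂ν :=
  (integral_indicator (measurable_prodMk_left hG)).symm

lemma stronglyMeasurable_sectionIntegral [SFinite ν] (hG : MeasurableSet G) (hf : Measurable f) :
    StronglyMeasurable (sectionIntegral ν f G) := by
  rw [funext fun ω => sectionIntegral_eq_integral_indicator (ν := ν) (f := f) hG ω]
  exact ((hf.comp measurable_snd).indicator hG).stronglyMeasurable.integral_prod_right'

lemma integrable_indicator_comp_snd (hG : MeasurableSet G) (hf : Measurable f)
    (hC : ∀ x, ‖f x‖₊ ≤ C) (hfin : (Pr.prod ν) G ≠ ∞) :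
    Integrable (G.indicator fun p => f p.2) (Pr.prod ν) :=
  (integrable_indicator_iff hG).2 <|
    integrableOn_of_nnnorm_le (hf.comp measurable_snd) (fun p => hC p.2) hfin

variable [SFinite ν]

lemma integrable_sectionIntegral (hG : MeasurableSet G) (hf : Measurable f)
    (hC : ∀ x, ‖f x‖₊ ≤ C) (hfin : (Pr.prod ν) G ≠ ∞) :
    Integrable (sectionIntegral ν f G) Pr :=
  (integrable_indicator_comp_snd hG hf hC hfin).integral_prod_left.congr
    (ae_of_all _ fun ω => (sectionIntegral_eq_integral_indicator hG ω).symm)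

lemma integral_sectionIntegral [SFinite Pr] (hG : MeasurableSet G) (hf : Measurable f)
    (hC : ∀ x, ‖f x‖₊ ≤ C) (hfin : (Pr.prod ν) G ≠ ∞) :
    ∫ ω, sectionIntegral ν f G ω ∂Pr = ∫ x, f x * coverProb Pr G x ∂ν := by
  simp_rw [sectionIntegral_eq_integral_indicator hG]
  rw [integral_integral_swap (f := fun ω x => G.indicator (fun p => f p.2) (ω, x))
    (integrable_indicator_comp_snd hG hf hC hfin)]
  refine integral_congr_ae (ae_of_all _ fun x => ?_)
  calc ∫ ω, {ω | (ω, x) ∈ G}.indicator (fun _ => f x) ω ∂Pr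
      = coverProb Pr G x * f x := integral_indicator_const _ (measurable_prodMk_right hG)
    _ = f x * coverProb Pr G x := mul_comm _ _

lemma integrable_mul_coverProb [SFinite Pr] (hG : MeasurableSet G) (hf : Measurable f)
    (hC : ∀ x, ‖f x‖₊ ≤ C) (hfin : (Pr.prod ν) G ≠ ∞) :
    Integrable (fun x => f x * coverProb Pr G x) ν := by
  rw [Measure.prod_apply_symm hG] at hfin
  exact (integrable_toReal_of_lintegral_ne_top
    (measurable_measure_prodMk_right hG).aemeasurable hfin).bdd_mul hf.aestronglyMeasurable
    (ae_of_all _ hC)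

theorem eLpNorm_one_sectionIntegral_sub_le (hG : MeasurableSet G)
    (hG' : MeasurableSet G') (hf : Measurable f) (hC : ∀ x, ‖f x‖₊ ≤ C)
    (hfin : (Pr.prod ν) G ≠ ∞)
    (hsub : ∀ᵐ ω ∂Pr, {x | (ω, x) ∈ G'} ⊆ {x | (ω, x) ∈ G}) :
    eLpNorm (sectionIntegral ν f G - sectionIntegral ν f G') 1 Pr
      ≤ C * (Pr.prod ν) (G \ G') := by
  have hfin_section : ∀ᵐ ω ∂Pr, ν {x | (ω, x) ∈ G} < ∞ :=
    ae_lt_top (measurable_measure_prodMk_left hG) (by rwa [Measure.prod_apply hG] at hfin)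
  rw [eLpNorm_one_eq_lintegral_enorm, Measure.prod_apply (hG.diff hG'),
    ← lintegral_const_mul' _ _ ENNReal.coe_ne_top]
  refine lintegral_mono_ae ?_
  filter_upwards [hfin_section, hsub] with ω hω hsubω
  calc ‖sectionIntegral ν f G ω - sectionIntegral ν f G' ω‖ₑ
      = ‖∫ x in {x | (ω, x) ∈ G} \ {x | (ω, x) ∈ G'}, f x ∂ν‖ₑ := by
        congr 1
        exact (setIntegral_sdiff (measurable_prodMk_left hG')
          (integrableOn_of_nnnorm_le hf hC hω.ne) hsubω).symm
    _ ≤ ∫⁻ x in {x | (ω, x) ∈ G} \ {x | (ω, x) ∈ G'}, ‖f x‖ₑ ∂ν :=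
        enorm_integral_le_lintegral_enorm _
    _ ≤ ∫⁻ _ in {x | (ω, x) ∈ G} \ {x | (ω, x) ∈ G'}, C ∂ν :=
        lintegral_mono fun x => enorm_le_coe.2 (hC x)
    _ = C * ν {x | (ω, x) ∈ G \ G'} := setLIntegral_const _ _

lemma prod_sectionSquare_ne_top [IsFiniteMeasure Pr] (hG : MeasurableSet G)
    (hfin : (Pr.prod ν) G ≠ ∞) (hcov : ∫⁻ p, ‖coverCov Pr G p‖ₑ ∂ν.prod ν ≠ ∞) :
    (Pr.prod (ν.prod ν)) (sectionSquare G) ≠ ∞ := by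
  have hPm : Measurable fun x => Pr {ω | (ω, x) ∈ G} := measurable_measure_prodMk_right hG
  have hPm_mul : Measurable fun p : E × E => Pr {ω | (ω, p.1) ∈ G} * Pr {ω | (ω, p.2) ∈ G} :=
    (hPm.comp measurable_fst).mul (hPm.comp measurable_snd)
  have hle (p : E × E) : Pr {ω | (ω, p) ∈ sectionSquare G}
      ≤ Pr {ω | (ω, p.1) ∈ G} * Pr {ω | (ω, p.2) ∈ G} + ‖coverCov Pr G p‖ₑ := by
    have hcov_add : coverProb Pr (sectionSquare G) p
        = coverProb Pr G p.1 * coverProb Pr G p.2 + coverCov Pr G p := (add_sub_cancel _ _).symm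
    rw [← enorm_coverProb, ← enorm_coverProb, ← enorm_coverProb, ← enorm_mul, hcov_add]
    exact enorm_add_le _ _
  rw [Measure.prod_apply_symm (measurableSet_sectionSquare hG)]
  refine ne_top_of_le_ne_top ?_ (lintegral_mono hle)
  rw [lintegral_add_left hPm_mul, lintegral_prod_mul hPm.aemeasurable hPm.aemeasurable]
  rw [Measure.prod_apply_symm hG] at hfin
  exact ENNReal.add_ne_top.2 ⟨ENNReal.mul_ne_top hfin hfin, hcov⟩

lemma memLp_two_sectionIntegral [IsFiniteMeasure Pr] (hG : MeasurableSet G) (hf : Measurable f)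
    (hC : ∀ x, ‖f x‖₊ ≤ C) (hfin : (Pr.prod ν) G ≠ ∞)
    (hcov : ∫⁻ p, ‖coverCov Pr G p‖ₑ ∂ν.prod ν ≠ ∞) :
    MemLp (sectionIntegral ν f G) 2 Pr := by
  rw [memLp_two_iff_integrable_sq (stronglyMeasurable_sectionIntegral hG hf).aestronglyMeasurable]
  exact (integrable_sectionIntegral (measurableSet_sectionSquare hG) (by fun_prop)
    (nnnorm_mul_le_mul_self hC) (prod_sectionSquare_ne_top hG hfin hcov)).congr
    (ae_of_all _ sectionIntegral_sectionSquare)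

theorem variance_sectionIntegral [IsProbabilityMeasure Pr] (hG : MeasurableSet G)
    (hf : Measurable f) (hC : ∀ x, ‖f x‖₊ ≤ C) (hfin : (Pr.prod ν) G ≠ ∞)
    (hcov : ∫⁻ p, ‖coverCov Pr G p‖ₑ ∂ν.prod ν ≠ ∞) :
    Var[sectionIntegral ν f G; Pr] = ∫ p, f p.1 * f p.2 * coverCov Pr G p ∂ν.prod ν := by
  have hsq := measurableSet_sectionSquare hG
  have hff : Measurable fun p : E × E => f p.1 * f p.2 := by fun_prop
  have hfin_sq := prod_sectionSquare_ne_top hG hfin hcov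
  have hmean := integrable_mul_coverProb hG hf hC hfin
  have hsecond : ∫ ω, (sectionIntegral ν f G ^ 2) ω ∂Pr
      = ∫ p, f p.1 * f p.2 * coverProb Pr (sectionSquare G) p ∂ν.prod ν := by
    rw [← integral_sectionIntegral hsq hff (nnnorm_mul_le_mul_self hC) hfin_sq]
    exact integral_congr_ae (ae_of_all _ fun ω => (sectionIntegral_sectionSquare ω).symm)
  rw [variance_eq_sub (memLp_two_sectionIntegral hG hf hC hfin hcov), hsecond,
    integral_sectionIntegral hG hf hC hfin, sq, ← integral_prod_mul,
    ← integral_sub (integrable_mul_coverProb hsq hff (nnnorm_mul_le_mul_self hC) hfin_sq)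
      (hmean.mul_prod hmean)]
  refine integral_congr_ae (ae_of_all _ fun p => ?_)
  simp only [coverCov]
  ring

lemma eLpNorm_two_sub_integral (X : Ω → ℝ) :
    eLpNorm (fun ω => X ω - ∫ ω', X ω' ∂Pr) 2 Pr = evariance X Pr ^ (1 / 2 : ℝ) := by
  rw [eLpNorm_eq_lintegral_rpow_enorm_toReal two_ne_zero ENNReal.ofNat_ne_top, evariance]
  simp only [ENNReal.toReal_ofNat, ENNReal.rpow_ofNat]

theorem eLpNorm_two_sectionIntegral_sub_integral_le [IsProbabilityMeasure Pr]
    (hG : MeasurableSet G) (hf : Measurable f) (hC : ∀ x, ‖f x‖₊ ≤ C)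
    (hfin : (Pr.prod ν) G ≠ ∞) (hcov : ∫⁻ p, ‖coverCov Pr G p‖ₑ ∂ν.prod ν ≠ ∞) :
    eLpNorm (fun ω => sectionIntegral ν f G ω - ∫ ω', sectionIntegral ν f G ω' ∂Pr) 2 Pr
      ≤ C * (∫⁻ p, ‖coverCov Pr G p‖ₑ ∂ν.prod ν) ^ (1 / 2 : ℝ) := by
  have hvar : evariance (sectionIntegral ν f G) Pr
      ≤ (C : ℝ≥0∞) ^ 2 * ∫⁻ p, ‖coverCov Pr G p‖ₑ ∂ν.prod ν := by
    rw [← ofReal_variance (memLp_two_sectionIntegral hG hf hC hfin hcov),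
      ← Real.enorm_of_nonneg (variance_nonneg _ _), variance_sectionIntegral hG hf hC hfin hcov,
      ← lintegral_const_mul' _ _ (by simp)]
    refine (enorm_integral_le_lintegral_enorm _).trans (lintegral_mono fun p => ?_)
    rw [enorm_mul, sq, ← ENNReal.coe_mul]
    exact mul_le_mul' (enorm_le_coe.2 (nnnorm_mul_le_mul_self hC p)) le_rfl
  rw [eLpNorm_two_sub_integral]
  refine (ENNReal.rpow_le_rpow hvar (by simp)).trans_eq ?_
  rw [ENNReal.mul_rpow_of_nonneg _ _ (by simp), ← ENNReal.rpow_natCast, ← ENNReal.rpow_mul]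
  simp

end RandomSet

section Hits

variable {Ω S : Type*} {N : Ω → Set S}

/-- The event that the random set `N` hits `B`. -/
def hitEvent (N : Ω → Set S) (B : Set S) : Set Ω := {ω | (N ω ∩ B).Nonempty}

lemma hitEvent_union (B B' : Set S) : hitEvent N (B ∪ B') = hitEvent N B ∪ hitEvent N B' := by
  ext ω
  simp only [hitEvent, Set.mem_ofPred_eq, Set.mem_union, Set.inter_union_distrib_left,
    Set.union_nonempty]

lemma compl_hitEvent_eq_preimage_encard (B : Set S) :
    (hitEvent N B)ᶜ = (fun ω => (N ω ∩ B).encard) ⁻¹' {0} := by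
  ext ω
  simp [hitEvent, Set.not_nonempty_iff_eq_empty]

lemma compl_hitEvent_eq_iInter_preimage {ι : Type*} {Y : ι → Ω → S}
    (hN : ∀ ω, N ω = Set.range fun i => Y i ω) (B : Set S) :
    (hitEvent N B)ᶜ = ⋂ i, Y i ⁻¹' Bᶜ := by
  ext ω
  simp [hitEvent, hN, Set.not_nonempty_iff_eq_empty, Set.eq_empty_iff_forall_notMem]

variable [MeasurableSpace Ω] [MeasurableSpace S] {Q : Measure S} {Pr : Measure Ω}

/-- A random set which is almost surely finite and whose hitting probabilities and their
covariances are close to those of a Poisson process with intensity `M • Q`: the common ground of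
Poisson and binomial processes. -/
structure HasPoissonLikeHits (N : Ω → Set S) (M : ℝ) (Q : Measure S) (Pr : Measure Ω) :
    Prop where
  intensity_nonneg : 0 ≤ M
  ae_finite : ∀ᵐ ω ∂Pr, (N ω).Finite
  measurableSet_hit : ∀ B, MeasurableSet B → MeasurableSet (hitEvent N B)
  hit_le : ∀ B, MeasurableSet B → Pr.real (hitEvent N B) ≤ M * Q.real B
  abs_hit_sub_le : ∀ B, MeasurableSet B →
    |Pr.real (hitEvent N B) - (1 - Real.exp (-(M * Q.real B)))| ≤ M * Q.real B ^ 2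
  abs_cov_le : ∀ B B', MeasurableSet B → MeasurableSet B' →
    |Pr.real (hitEvent N B ∩ hitEvent N B') - Pr.real (hitEvent N B) * Pr.real (hitEvent N B')|
      ≤ M * (Q.real (B ∩ B') + Q.real B * Q.real B')

theorem HasPoissonLikeHits.of_avoidance [IsProbabilityMeasure Pr] [IsProbabilityMeasure Q] {M : ℝ}
    (hM : 0 ≤ M) (v : ℝ → ℝ) (hfin : ∀ᵐ ω ∂Pr, (N ω).Finite)
    (hmeas : ∀ B, MeasurableSet B → MeasurableSet (hitEvent N B))
    (hv : ∀ B, MeasurableSet B → Pr.real (hitEvent N B)ᶜ = v (Q.real B))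
    (hv_le : ∀ b, 0 ≤ b → b ≤ 1 → 1 - M * b ≤ v b)
    (hv_exp : ∀ b, 0 ≤ b → b ≤ 1 → |v b - Real.exp (-(M * b))| ≤ M * b ^ 2)
    (hv_mul : ∀ a b c, 0 ≤ c → c ≤ a → c ≤ b → a ≤ 1 → b ≤ 1 →
      |v (a + b - c) - v a * v b| ≤ M * (c + a * b)) :
    HasPoissonLikeHits N M Q Pr := by
  have hhit (B : Set S) (hB : MeasurableSet B) : Pr.real (hitEvent N B) = 1 - v (Q.real B) := by
    rw [← hv B hB, probReal_compl_eq_one_sub (hmeas B hB), sub_sub_cancel]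
  refine ⟨hM, hfin, hmeas, fun B hB => ?_, fun B hB => ?_, fun B B' hB hB' => ?_⟩
  · rw [hhit B hB]
    linarith [hv_le (Q.real B) measureReal_nonneg measureReal_le_one]
  · rw [hhit B hB, sub_sub_sub_cancel_left, abs_sub_comm]
    exact hv_exp _ measureReal_nonneg measureReal_le_one
  · have hPr := measureReal_union_add_inter (μ := Pr) (s := hitEvent N B) (hmeas B' hB')
    have hQ : Q.real B + Q.real B' - Q.real (B ∩ B') = Q.real (B ∪ B') := by
      rw [← measureReal_union_add_inter (μ := Q) (s := B) hB', add_sub_cancel_right]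
    have hmul := hv_mul (Q.real B) (Q.real B') (Q.real (B ∩ B')) measureReal_nonneg
      (measureReal_mono Set.inter_subset_left) (measureReal_mono Set.inter_subset_right)
      measureReal_le_one measureReal_le_one
    rw [hQ] at hmul
    rw [← hitEvent_union, hhit _ (hB.union hB'), hhit B hB, hhit B' hB'] at hPr
    rw [hhit B hB, hhit B' hB']
    convert hmul using 2
    linarith

lemma abs_exp_neg_sub_mul_exp_neg_le {M a b c : ℝ} (hM : 0 ≤ M) (hc : 0 ≤ c) (hca : c ≤ a)
    (hb : 0 ≤ b) :
    |Real.exp (-(M * (a + b - c))) - Real.exp (-(M * a)) * Real.exp (-(M * b))| ≤ M * c := by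
  have hfactor : Real.exp (-(M * (a + b - c))) - Real.exp (-(M * a)) * Real.exp (-(M * b))
      = Real.exp (-(M * (a + b - c))) * (1 - Real.exp (-(M * c))) := by
    rw [mul_sub (Real.exp _), mul_one, ← Real.exp_add, ← Real.exp_add]
    ring_nf
  have hc_exp : Real.exp (-(M * c)) ≤ 1 := Real.exp_le_one_iff.2 (by nlinarith)
  have habc_exp : Real.exp (-(M * (a + b - c))) ≤ 1 := Real.exp_le_one_iff.2 (by nlinarith)
  rw [hfactor, abs_of_nonneg (mul_nonneg (Real.exp_pos _).le (by linarith))]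
  refine (mul_le_of_le_one_left (by linarith) habc_exp).trans ?_
  linarith [Real.one_sub_le_exp_neg (M * c)]

lemma IsPoissonProcess.measurableSet_hitEvent {Λ : Measure S} (h : IsPoissonProcess N Λ Pr)
    {B : Set S} (hB : MeasurableSet B) : MeasurableSet (hitEvent N B) := by
  rw [← compl_compl (hitEvent N B), compl_hitEvent_eq_preimage_encard]
  exact (h.measurable_count B hB (measurableSet_singleton _)).compl

lemma IsPoissonProcess.measure_count_preimage {Λ : Measure S} (h : IsPoissonProcess N Λ Pr)
    {B : Set S} (hB : MeasurableSet B) (hΛ : Λ B ≠ ∞) (k : ℕ∞) :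
    Pr ((fun ω => (N ω ∩ B).encard) ⁻¹' {k})
      = poissonMeasure (Λ B).toNNReal ((Nat.cast : ℕ → ℕ∞) ⁻¹' {k}) := by
  rw [← Measure.map_apply (h.measurable_count B hB) (measurableSet_singleton _),
    h.law_count B hB hΛ, Measure.map_apply measurable_from_top (measurableSet_singleton _)]

lemma IsPoissonProcess.ae_finite {Λ : Measure S} [IsFiniteMeasure Λ]
    (h : IsPoissonProcess N Λ Pr) : ∀ᵐ ω ∂Pr, (N ω).Finite := by
  have htop : (Nat.cast : ℕ → ℕ∞) ⁻¹' {⊤} = ∅ := by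
    ext
    simp
  have hnull := h.measure_count_preimage MeasurableSet.univ (measure_ne_top Λ _) ⊤
  rw [htop, measure_empty] at hnull
  filter_upwards [measure_eq_zero_iff_ae_notMem.1 hnull] with ω hω
  simpa [Set.encard_eq_top_iff] using hω

lemma IsPoissonProcess.measureReal_compl_hitEvent {Λ : Measure S} [IsFiniteMeasure Λ]
    (h : IsPoissonProcess N Λ Pr) {B : Set S} (hB : MeasurableSet B) :
    Pr.real (hitEvent N B)ᶜ = Real.exp (-Λ.real B) := by
  have hzero : (Nat.cast : ℕ → ℕ∞) ⁻¹' {0} = {0} := by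
    ext
    simp
  rw [compl_hitEvent_eq_preimage_encard, measureReal_def,
    h.measure_count_preimage hB (measure_ne_top Λ _), hzero, ← measureReal_def,
    poissonMeasure_real_singleton]
  simp [measureReal_def, ENNReal.coe_toNNReal_eq_toReal]

theorem IsPoissonProcess.hasPoissonLikeHits {l : ℝ} (hl : 0 ≤ l) [IsProbabilityMeasure Pr]
    [IsProbabilityMeasure Q] (h : IsPoissonProcess N (ENNReal.ofReal l • Q) Pr) :
    HasPoissonLikeHits N l Q Pr := by
  have : IsFiniteMeasure (ENNReal.ofReal l • Q) := Q.smul_finite ENNReal.ofReal_ne_top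
  refine .of_avoidance hl (fun b => Real.exp (-(l * b))) h.ae_finite
    (fun B => h.measurableSet_hitEvent) (fun B hB => ?_)
    (fun b _ _ => Real.one_sub_le_exp_neg _) (fun b _ _ => ?_)
    (fun a b c hc hca hcb _ _ => ?_)
  · rw [h.measureReal_compl_hitEvent hB]
    simp [measureReal_def, hl]
  · simpa using mul_nonneg hl (sq_nonneg b)
  · refine (abs_exp_neg_sub_mul_exp_neg_le hl hc hca (hc.trans hcb)).trans ?_
    have hab := mul_nonneg (hc.trans hca) (hc.trans hcb)
    exact mul_le_mul_of_nonneg_left (by linarith) hl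

lemma abs_pow_sub_pow_le_of_abs_le_one {a b : ℝ} (ha : |a| ≤ 1) (hb : |b| ≤ 1) (n : ℕ) :
    |a ^ n - b ^ n| ≤ n * |a - b| := by
  refine (abs_pow_sub_pow_le a b n).trans ?_
  rw [mul_comm |a - b|]
  exact mul_le_of_le_one_right (by positivity) (pow_le_one₀ (by positivity) (max_le ha hb))

lemma abs_one_sub_pow_sub_exp_neg_le {b : ℝ} (hb : 0 ≤ b) (hb1 : b ≤ 1) (n : ℕ) :
    |(1 - b) ^ n - Real.exp (-(n * b))| ≤ n * b ^ 2 := by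
  have hexp : Real.exp (-(n * b)) = Real.exp (-b) ^ n := by
    rw [← Real.exp_nat_mul, mul_neg]
  have hexp_le : |Real.exp (-b)| ≤ 1 := by
    rw [Real.abs_exp]
    exact Real.exp_le_one_iff.2 (by linarith)
  have htaylor : |1 - b - Real.exp (-b)| ≤ b ^ 2 := by
    have h := Real.abs_exp_sub_one_sub_id_le (x := -b) (by rwa [abs_neg, abs_of_nonneg hb])
    rwa [neg_sq, abs_sub_comm, ← sub_add, sub_add_eq_add_sub, neg_add_eq_sub] at h
  rw [hexp]
  exact (abs_pow_sub_pow_le_of_abs_le_one (abs_le.2 ⟨by linarith, by linarith⟩) hexp_le n).trans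
    (mul_le_mul_of_nonneg_left htaylor n.cast_nonneg)

lemma abs_one_sub_pow_sub_mul_one_sub_pow_le {a b c : ℝ} (hc : 0 ≤ c) (hca : c ≤ a) (hcb : c ≤ b)
    (ha : a ≤ 1) (hb : b ≤ 1) (n : ℕ) :
    |(1 - (a + b - c)) ^ n - (1 - a) ^ n * (1 - b) ^ n| ≤ n * (c + a * b) := by
  have hunion : |1 - (a + b - c)| ≤ 1 := abs_le.2 ⟨by linarith, by linarith⟩
  have hprod : |(1 - a) * (1 - b)| ≤ 1 := by
    rw [abs_of_nonneg (mul_nonneg (by linarith) (by linarith))]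
    exact mul_le_one₀ (by linarith) (by linarith) (by linarith)
  rw [← mul_pow]
  refine (abs_pow_sub_pow_le_of_abs_le_one hunion hprod n).trans
    (mul_le_mul_of_nonneg_left ?_ n.cast_nonneg)
  have hab := mul_nonneg (hc.trans hca) (hc.trans hcb)
  exact abs_le.2 ⟨by nlinarith, by nlinarith⟩

theorem IsBinomialProcess.hasPoissonLikeHits {n : ℕ} [IsProbabilityMeasure Pr]
    [IsProbabilityMeasure Q] (h : IsBinomialProcess N n Q Pr) :
    HasPoissonLikeHits N n Q Pr := by
  obtain ⟨Y, hY, hlaw, hind, hN⟩ := h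
  refine .of_avoidance n.cast_nonneg (fun b => (1 - b) ^ n) (ae_of_all _ fun ω => ?_)
    (fun B hB => ?_) (fun B hB => ?_) (fun b _ hb => ?_)
    (fun b hb hb1 => abs_one_sub_pow_sub_exp_neg_le hb hb1 n)
    (fun a b c hc hca hcb ha hb => abs_one_sub_pow_sub_mul_one_sub_pow_le hc hca hcb ha hb n)
  · exact hN ω ▸ Set.finite_range _
  · rw [← compl_compl (hitEvent N B), compl_hitEvent_eq_iInter_preimage hN]
    exact (MeasurableSet.iInter fun i => hY i hB.compl).compl
  · have hmiss (i : Fin n) : (Pr (Y i ⁻¹' Bᶜ)).toReal = 1 - Q.real B := by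
      rw [← Measure.map_apply (hY i) hB.compl, hlaw, ← measureReal_def,
        probReal_compl_eq_one_sub hB]
    have hindep := hind.measure_inter_preimage_eq_mul Finset.univ fun _ _ => hB.compl
    simp only [Finset.mem_univ, Set.iInter_true] at hindep
    rw [compl_hitEvent_eq_iInter_preimage hN, measureReal_def, hindep, ENNReal.toReal_prod,
      Finset.prod_congr rfl fun i _ => hmiss i, Finset.prod_const, Finset.card_univ,
      Fintype.card_fin]
  · have hbernoulli := one_add_mul_le_pow (a := -b) (by linarith) n
    rwa [mul_neg, ← sub_eq_add_neg, ← sub_eq_add_neg] at hbernoulli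

lemma HasPoissonLikeHits.measure_hitEvent_le [IsFiniteMeasure Pr] [IsFiniteMeasure Q]
    {M : ℝ} (hN : HasPoissonLikeHits N M Q Pr) {B : Set S} (hB : MeasurableSet B) :
    Pr (hitEvent N B) ≤ ENNReal.ofReal M * Q B := by
  rw [← ofReal_measureReal (μ := Pr), ← ofReal_measureReal (μ := Q),
    ← ENNReal.ofReal_mul hN.intensity_nonneg]
  exact ENNReal.ofReal_le_ofReal (hN.hit_le B hB)

lemma abs_exp_neg_sub_exp_neg_le {a b : ℝ} (ha : 0 ≤ a) (hb : 0 ≤ b) :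
    |Real.exp (-a) - Real.exp (-b)| ≤ |a - b| := by
  wlog hab : a ≤ b generalizing a b
  · rw [abs_sub_comm, abs_sub_comm a]
    exact this hb ha (le_of_not_ge hab)
  have hfactor : Real.exp (-a) - Real.exp (-b) = Real.exp (-a) * (1 - Real.exp (-(b - a))) := by
    rw [mul_sub, ← Real.exp_add, mul_one]
    ring_nf
  have hexp_le : Real.exp (-(b - a)) ≤ 1 := Real.exp_le_one_iff.2 (by linarith)
  rw [hfactor, abs_of_nonneg (mul_nonneg (Real.exp_pos _).le (by linarith)), abs_sub_comm,
    abs_of_nonneg (sub_nonneg.2 hab)]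
  refine (mul_le_of_le_one_left (by linarith) (Real.exp_le_one_iff.2 (by linarith))).trans ?_
  linarith [Real.one_sub_le_exp_neg (b - a)]

lemma HasPoissonLikeHits.abs_hitEvent_sub_le [IsProbabilityMeasure Q] {M : ℝ}
    (hN : HasPoissonLikeHits N M Q Pr) {B : Set S} (hB : MeasurableSet B) {b : ℝ} (hb : 0 ≤ b) :
    |Pr.real (hitEvent N B) - (1 - Real.exp (-b))| ≤ 2 * |M * Q.real B - b| + b * Q.real B := by
  have hMQ : 0 ≤ M * Q.real B := mul_nonneg hN.intensity_nonneg measureReal_nonneg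
  have hsq : M * Q.real B ^ 2 ≤ |M * Q.real B - b| + b * Q.real B :=
    calc M * Q.real B ^ 2 = (M * Q.real B - b) * Q.real B + b * Q.real B := by ring
      _ ≤ |M * Q.real B - b| * 1 + b * Q.real B := by
        gcongr
        · exact le_abs_self _
        · exact measureReal_le_one
      _ = |M * Q.real B - b| + b * Q.real B := by rw [mul_one]
  have hexp := abs_exp_neg_sub_exp_neg_le hMQ hb
  have htri := abs_sub_le (Pr.real (hitEvent N B)) (1 - Real.exp (-(M * Q.real B)))
    (1 - Real.exp (-b))
  rw [sub_sub_sub_cancel_left, abs_sub_comm (Real.exp (-b))] at htri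
  linarith [hN.abs_hit_sub_le B hB]

end Hits

section Coverage

variable {Ω E S : Type*} [MeasurableSpace Ω] [MeasurableSpace E]

/-- The sections of `G` are almost surely the random set of all `x` such that `N` hits `W x`. Only
almost sure agreement is required because the latter set need not depend measurably on `ω` where
`N ω` is infinite. -/
structure IsCoverage (N : Ω → Set S) (W : E → Set S) (G : Set (Ω × E)) (Pr : Measure Ω) :
    Prop where
  measurableSet : MeasurableSet G
  ae_mem_iff : ∀ᵐ ω ∂Pr, ∀ x, (ω, x) ∈ G ↔ ω ∈ hitEvent N (W x)

variable {Pr : Measure Ω} {N : Ω → Set S} {W W' : E → Set S} {G G' : Set (Ω × E)}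

lemma IsCoverage.coverProb_eq (hG : IsCoverage N W G Pr) (x : E) :
    coverProb Pr G x = Pr.real (hitEvent N (W x)) := by
  refine measureReal_congr ?_
  filter_upwards [hG.ae_mem_iff] with ω hω
  exact propext (hω x)

lemma IsCoverage.coverProb_sectionSquare_eq (hG : IsCoverage N W G Pr) (p : E × E) :
    coverProb Pr (sectionSquare G) p = Pr.real (hitEvent N (W p.1) ∩ hitEvent N (W p.2)) := by
  refine measureReal_congr ?_
  filter_upwards [hG.ae_mem_iff] with ω hω
  exact propext (and_congr (hω p.1) (hω p.2))

variable [MeasurableSpace S] {ν : Measure E} {Q : Measure S} {M : ℝ} {f g : E → ℝ} {C : ℝ≥0}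

lemma lintegral_measure_section [SFinite ν] [SFinite Q]
    (hW : MeasurableSet {p : E × S | p.2 ∈ W p.1}) :
    ∫⁻ x, Q (W x) ∂ν = ∫⁻ z, ν {x | z ∈ W x} ∂Q :=
  (Measure.prod_apply hW).symm.trans (Measure.prod_apply_symm hW)

lemma measurableSet_section (hW : MeasurableSet {p : E × S | p.2 ∈ W p.1}) (x : E) :
    MeasurableSet (W x) :=
  measurable_prodMk_left hW

lemma measurable_measure_section [SFinite Q] (hW : MeasurableSet {p : E × S | p.2 ∈ W p.1}) :
    Measurable fun x => Q (W x) :=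
  measurable_measure_prodMk_left hW

lemma measurableSet_inter_section (hW : MeasurableSet {p : E × S | p.2 ∈ W p.1}) :
    MeasurableSet {p : (E × E) × S | p.2 ∈ W p.1.1 ∩ W p.1.2} := by
  have hfst : Measurable fun p : (E × E) × S => (p.1.1, p.2) := by fun_prop
  have hsnd : Measurable fun p : (E × E) × S => (p.1.2, p.2) := by fun_prop
  exact (hfst hW).inter (hsnd hW)

lemma lintegral_measure_inter_section [SFinite ν] [SFinite Q]
    (hW : MeasurableSet {p : E × S | p.2 ∈ W p.1}) :
    ∫⁻ p, Q (W p.1 ∩ W p.2) ∂ν.prod ν = ∫⁻ z, ν {x | z ∈ W x} ^ 2 ∂Q := by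
  rw [lintegral_measure_section (W := fun p : E × E => W p.1 ∩ W p.2)
    (measurableSet_inter_section hW)]
  refine lintegral_congr fun z => ?_
  rw [sq]
  exact Measure.prod_prod {x | z ∈ W x} {x | z ∈ W x}

lemma IsCoverage.lintegral_enorm_coverCov_le [SFinite ν] [IsFiniteMeasure Q]
    (hG : IsCoverage N W G Pr) (hN : HasPoissonLikeHits N M Q Pr)
    (hW : MeasurableSet {p : E × S | p.2 ∈ W p.1}) :
    ∫⁻ p, ‖coverCov Pr G p‖ₑ ∂ν.prod ν
      ≤ ENNReal.ofReal M * (∫⁻ z, ν {x | z ∈ W x} ^ 2 ∂Q + (∫⁻ x, Q (W x) ∂ν) ^ 2) := by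
  have hQ := (measurable_measure_section (Q := Q) hW).aemeasurable (μ := ν)
  have hQ_inter := measurable_measure_section (Q := Q) (W := fun p : E × E => W p.1 ∩ W p.2)
    (measurableSet_inter_section hW)
  have hle (p : E × E) : ‖coverCov Pr G p‖ₑ
      ≤ ENNReal.ofReal M * (Q (W p.1 ∩ W p.2) + Q (W p.1) * Q (W p.2)) := by
    rw [coverCov, hG.coverProb_sectionSquare_eq, hG.coverProb_eq, hG.coverProb_eq,
      Real.enorm_eq_ofReal_abs]
    refine (ENNReal.ofReal_le_ofReal (hN.abs_cov_le _ _ (measurableSet_section hW p.1)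
      (measurableSet_section hW p.2))).trans_eq ?_
    rw [ENNReal.ofReal_mul hN.intensity_nonneg, ENNReal.ofReal_add measureReal_nonneg
      (mul_nonneg measureReal_nonneg measureReal_nonneg),
      ENNReal.ofReal_mul measureReal_nonneg, ofReal_measureReal, ofReal_measureReal,
      ofReal_measureReal]
  refine (lintegral_mono hle).trans_eq ?_
  rw [lintegral_const_mul' _ _ ENNReal.ofReal_ne_top, lintegral_add_left hQ_inter,
    lintegral_measure_inter_section hW, lintegral_prod_mul hQ hQ, sq (∫⁻ x, Q (W x) ∂ν)]

lemma integrable_mul_one_sub_exp_neg (hf : Measurable f) (hC : ∀ x, ‖f x‖₊ ≤ C)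
    (hg0 : ∀ x, 0 ≤ g x) (hg : Integrable g ν) :
    Integrable (fun x => f x * (1 - Real.exp (-g x))) ν := by
  refine Integrable.bdd_mul (hg.mono ?_ (ae_of_all _ fun x => ?_)) hf.aestronglyMeasurable
    (ae_of_all _ hC)
  · exact aestronglyMeasurable_const.sub (Real.continuous_exp.comp_aestronglyMeasurable hg.1.neg)
  · have h := abs_exp_neg_sub_exp_neg_le le_rfl (hg0 x)
    rwa [neg_zero, Real.exp_zero, zero_sub, abs_neg] at h

section FiniteMeasure

variable [SFinite ν] [IsFiniteMeasure Pr] [IsFiniteMeasure Q]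

lemma IsCoverage.prod_le (hG : IsCoverage N W G Pr) (hN : HasPoissonLikeHits N M Q Pr)
    (hW : MeasurableSet {p : E × S | p.2 ∈ W p.1}) :
    (Pr.prod ν) G ≤ ENNReal.ofReal M * ∫⁻ x, Q (W x) ∂ν := by
  rw [Measure.prod_apply_symm hG.measurableSet, ← lintegral_const_mul' _ _ ENNReal.ofReal_ne_top]
  refine lintegral_mono fun x => ?_
  calc Pr {ω | (ω, x) ∈ G} = Pr (hitEvent N (W x)) := measure_congr <| by
        filter_upwards [hG.ae_mem_iff] with ω hω using propext (hω x)
    _ ≤ ENNReal.ofReal M * Q (W x) := hN.measure_hitEvent_le (measurableSet_section hW x)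

lemma IsCoverage.prod_ne_top (hG : IsCoverage N W G Pr) (hN : HasPoissonLikeHits N M Q Pr)
    (hW : MeasurableSet {p : E × S | p.2 ∈ W p.1}) (hfin : ∫⁻ x, Q (W x) ∂ν ≠ ∞) :
    (Pr.prod ν) G ≠ ∞ :=
  ne_top_of_le_ne_top (ENNReal.mul_ne_top ENNReal.ofReal_ne_top hfin) (hG.prod_le hN hW)

lemma IsCoverage.prod_diff_le (hG : IsCoverage N W G Pr) (hG' : IsCoverage N W' G' Pr)
    (hN : HasPoissonLikeHits N M Q Pr) (hW : MeasurableSet {p : E × S | p.2 ∈ W p.1})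
    (hW' : MeasurableSet {p : E × S | p.2 ∈ W' p.1}) :
    (Pr.prod ν) (G \ G') ≤ ENNReal.ofReal M * ∫⁻ x, Q (W x \ W' x) ∂ν := by
  rw [Measure.prod_apply_symm (hG.measurableSet.diff hG'.measurableSet),
    ← lintegral_const_mul' _ _ ENNReal.ofReal_ne_top]
  refine lintegral_mono fun x => (measure_mono_ae ?_).trans (hN.measure_hitEvent_le
    ((measurableSet_section hW x).diff (measurableSet_section hW' x)))
  filter_upwards [hG.ae_mem_iff, hG'.ae_mem_iff] with ω hω hω' hmem
  obtain ⟨z, hzN, hzW⟩ := (hω x).1 hmem.1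
  exact ⟨z, hzN, hzW, fun hzW' => hmem.2 ((hω' x).2 ⟨z, hzN, hzW'⟩)⟩

theorem IsCoverage.eLpNorm_one_sectionIntegral_sub_le (hG : IsCoverage N W G Pr)
    (hG' : IsCoverage N W' G' Pr) (hN : HasPoissonLikeHits N M Q Pr)
    (hW : MeasurableSet {p : E × S | p.2 ∈ W p.1})
    (hW' : MeasurableSet {p : E × S | p.2 ∈ W' p.1}) (hsub : ∀ x, W' x ⊆ W x)
    (hfin : ∫⁻ x, Q (W x) ∂ν ≠ ∞) (hf : Measurable f) (hC : ∀ x, ‖f x‖₊ ≤ C) :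
    eLpNorm (sectionIntegral ν f G - sectionIntegral ν f G') 1 Pr
      ≤ C * (ENNReal.ofReal M * ∫⁻ x, Q (W x \ W' x) ∂ν) := by
  refine (GermGrain.eLpNorm_one_sectionIntegral_sub_le hG.measurableSet hG'.measurableSet hf hC
    (hG.prod_ne_top hN hW hfin) ?_).trans (mul_le_mul' le_rfl (hG.prod_diff_le hG' hN hW hW'))
  filter_upwards [hG.ae_mem_iff, hG'.ae_mem_iff] with ω hω hω' x hx
  obtain ⟨z, hzN, hzW'⟩ := (hω' x).1 hx
  exact (hω x).2 ⟨z, hzN, hsub x hzW'⟩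

end FiniteMeasure

variable [SFinite ν] [IsProbabilityMeasure Pr] [IsProbabilityMeasure Q]

theorem IsCoverage.eLpNorm_two_sectionIntegral_sub_integral_le (hG : IsCoverage N W G Pr)
    (hN : HasPoissonLikeHits N M Q Pr) (hW : MeasurableSet {p : E × S | p.2 ∈ W p.1})
    (hfin : ∫⁻ x, Q (W x) ∂ν ≠ ∞) (hfin_sq : ∫⁻ z, ν {x | z ∈ W x} ^ 2 ∂Q ≠ ∞)
    (hf : Measurable f) (hC : ∀ x, ‖f x‖₊ ≤ C) :
    eLpNorm (fun ω => sectionIntegral ν f G ω - ∫ ω', sectionIntegral ν f G ω' ∂Pr) 2 Pr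
      ≤ C * (ENNReal.ofReal M *
        (∫⁻ z, ν {x | z ∈ W x} ^ 2 ∂Q + (∫⁻ x, Q (W x) ∂ν) ^ 2)) ^ (1 / 2 : ℝ) := by
  have hcov := hG.lintegral_enorm_coverCov_le (ν := ν) hN hW
  have hcov_fin := ne_top_of_le_ne_top (ENNReal.mul_ne_top ENNReal.ofReal_ne_top
    (ENNReal.add_ne_top.2 ⟨hfin_sq, ENNReal.pow_ne_top hfin⟩)) hcov
  exact (GermGrain.eLpNorm_two_sectionIntegral_sub_integral_le hG.measurableSet hf hC
    (hG.prod_ne_top hN hW hfin) hcov_fin).trans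
    (mul_le_mul' le_rfl (ENNReal.rpow_le_rpow hcov (by simp)))

theorem IsCoverage.enorm_integral_sectionIntegral_sub_le (hG : IsCoverage N W G Pr)
    (hN : HasPoissonLikeHits N M Q Pr) (hW : MeasurableSet {p : E × S | p.2 ∈ W p.1})
    (hfin : ∫⁻ x, Q (W x) ∂ν ≠ ∞) (hf : Measurable f) (hC : ∀ x, ‖f x‖₊ ≤ C)
    (hg0 : ∀ x, 0 ≤ g x) (hg : Integrable g ν) :
    ‖∫ ω, sectionIntegral ν f G ω ∂Pr - ∫ x, f x * (1 - Real.exp (-g x)) ∂ν‖ₑ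
      ≤ C * (2 * ∫⁻ x, ‖M * Q.real (W x) - g x‖ₑ ∂ν
        + ∫⁻ x, ENNReal.ofReal (g x) * Q (W x) ∂ν) := by
  have hG_fin := hG.prod_ne_top hN hW hfin
  have hgQ : AEMeasurable (fun x => ENNReal.ofReal (g x) * Q (W x)) ν :=
    hg.1.aemeasurable.ennreal_ofReal.mul (measurable_measure_section hW).aemeasurable
  have hle (x : E) : ‖f x * coverProb Pr G x - f x * (1 - Real.exp (-g x))‖ₑ
      ≤ C * (2 * ‖M * Q.real (W x) - g x‖ₑ + ENNReal.ofReal (g x) * Q (W x)) := by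
    rw [← mul_sub, enorm_mul, hG.coverProb_eq, Real.enorm_eq_ofReal_abs (_ - _),
      Real.enorm_eq_ofReal_abs (_ - _)]
    refine mul_le_mul' (enorm_le_coe.2 (hC x)) ((ENNReal.ofReal_le_ofReal
      (hN.abs_hitEvent_sub_le (measurableSet_section hW x) (hg0 x))).trans_eq ?_)
    rw [ENNReal.ofReal_add (by positivity) (mul_nonneg (hg0 x) measureReal_nonneg),
      ENNReal.ofReal_mul zero_le_two, ENNReal.ofReal_mul (hg0 x), ofReal_measureReal,
      ENNReal.ofReal_ofNat]
  rw [integral_sectionIntegral hG.measurableSet hf hC hG_fin,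
    ← integral_sub (integrable_mul_coverProb hG.measurableSet hf hC hG_fin)
      (integrable_mul_one_sub_exp_neg hf hC hg0 hg)]
  refine (enorm_integral_le_lintegral_enorm _).trans ((lintegral_mono hle).trans_eq ?_)
  rw [lintegral_const_mul' _ _ ENNReal.coe_ne_top, lintegral_add_right' _ hgQ,
    lintegral_const_mul' _ _ ENNReal.ofNat_ne_top]

end Coverage

section Translation

lemma tendsto_lintegral_enorm_translate_sub {G F : Type*} [AddGroup G] [TopologicalSpace G]
    [IsTopologicalAddGroup G] [MeasurableSpace G] [BorelSpace G] [NormedAddCommGroup F]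
    {μ : Measure G} [IsLocallyFiniteMeasure μ] [μ.InnerRegularCompactLTTop] [μ.IsAddLeftInvariant]
    {g : G → F} (hg : Integrable g μ) :
    Tendsto (fun v => ∫⁻ x, ‖g (v + x) - g x‖ₑ ∂μ) (𝓝 0) (𝓝 0) := by
  have : Fact ((1 : ℝ≥0∞) ≠ ∞) := ⟨ENNReal.one_ne_top⟩
  have hg_memLp := memLp_one_iff_integrable.2 hg
  have hcont : Continuous fun v : G =>
      edist (DomAddAct.mk v +ᵥ hg_memLp.toLp g) (DomAddAct.mk (0 : G) +ᵥ hg_memLp.toLp g) := by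
    fun_prop
  have hlim := hcont.tendsto 0
  rw [edist_self] at hlim
  refine hlim.congr fun v => ?_
  rw [DomAddAct.mk_vadd_toLp, DomAddAct.mk_vadd_toLp, Lp.edist_toLp_toLp,
    eLpNorm_one_eq_lintegral_enorm]
  simp only [Pi.sub_apply, vadd_eq_add, zero_add]

lemma lintegral_enorm_translate_sub_le {G : Type*} [AddGroup G] [MeasurableSpace G]
    [MeasurableAdd G] {μ : Measure G} [μ.IsAddLeftInvariant] {F : Type*} [NormedAddCommGroup F]
    {g : G → F} (hg : AEStronglyMeasurable g μ) (v : G) :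
    ∫⁻ x, ‖g (v + x) - g x‖ₑ ∂μ ≤ 2 * ∫⁻ x, ‖g x‖ₑ ∂μ :=
  calc ∫⁻ x, ‖g (v + x) - g x‖ₑ ∂μ ≤ ∫⁻ x, (‖g (v + x)‖ₑ + ‖g x‖ₑ) ∂μ :=
        lintegral_mono fun _ => enorm_sub_le
    _ = 2 * ∫⁻ x, ‖g x‖ₑ ∂μ := by
        rw [lintegral_add_right' _ hg.enorm, lintegral_add_left_eq_self (fun x => ‖g x‖ₑ), two_mul]

variable {E : Type*} [NormedAddCommGroup E] [NormedSpace ℝ E] [MeasureSpace E] [BorelSpace E]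
  [FiniteDimensional ℝ E] [(volume : Measure E).IsAddHaarMeasure]

lemma lintegral_eq_lintegral_sub_smul {s : ℝ} (hs : 0 < s) (x : E) {g : E → ℝ≥0∞}
    (hg : Measurable g) :
    ∫⁻ y, g y = ENNReal.ofReal (s ^ Module.finrank ℝ E) * ∫⁻ u, g (x - s • u) := by
  have hscale : ∫⁻ u, g (x - s • u)
      = ENNReal.ofReal ((s ^ Module.finrank ℝ E)⁻¹) * ∫⁻ y, g (x - y) := by
    have hmap := Measure.map_addHaar_smul (volume : Measure E) hs.ne'
    rw [abs_of_pos (by positivity)] at hmap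
    rw [← smul_eq_mul, ← lintegral_smul_measure, ← hmap,
      lintegral_map (by fun_prop) (by fun_prop)]
  rw [hscale, ← mul_assoc, ← ENNReal.ofReal_mul (by positivity), mul_inv_cancel₀ (by positivity),
    ENNReal.ofReal_one, one_mul, lintegral_sub_left_eq_self]

end Translation

section Grains

section Compacts

variable {α : Type*} [TopologicalSpace α] [T2Space α]

lemma isClosed_setOf_mem_compacts : IsClosed {p : Compacts α × α | p.2 ∈ p.1} := by
  rw [← isOpen_compl_iff]
  have hcont : Continuous fun p : Compacts α × α => (({p.2} : Compacts α), p.1) :=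
    (Compacts.continuous_singleton.comp continuous_snd).prodMk continuous_fst
  convert Compacts.isOpen_setOfPred_disjoint_coe.preimage hcont using 1
  ext p
  simp

variable [SecondCountableTopology α] [MeasurableSpace α] [BorelSpace α]

lemma measurableSet_setOf_mem_compacts : MeasurableSet {p : Compacts α × α | p.2 ∈ p.1} :=
  isClosed_setOf_mem_compacts.measurableSet

lemma measurable_measure_compacts (ν : Measure α) [SFinite ν] :
    Measurable fun t : Compacts α => ν t :=
  measurable_measure_prodMk_left measurableSet_setOf_mem_compacts

end Compacts

variable {E : Type*} [NormedAddCommGroup E] [NormedSpace ℝ E] {s : ℝ} {A : Set (Compacts E)}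

/-- The set of pairs of a germ `z.1` and a grain `z.2` in `A` such that the translate by the germ
of the grain scaled by `s` covers `x`. The restriction to `A` is used for truncation by the volume
of the grains. -/
def grainCover (s : ℝ) (A : Set (Compacts E)) (x : E) : Set (E × Compacts E) :=
  {z | z.2 ∈ A ∧ x ∈ (fun u => z.1 + s • u) '' (z.2 : Set E)}

lemma mem_grainCover_iff (hs : s ≠ 0) {x : E} {z : E × Compacts E} :
    z ∈ grainCover s A x ↔ z.2 ∈ A ∧ s⁻¹ • (x - z.1) ∈ z.2 := by
  refine and_congr_right fun _ => ⟨?_, fun h => ⟨_, h, ?_⟩⟩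
  · rintro ⟨u, hu, rfl⟩
    simpa [smul_smul, hs] using hu
  · simp [smul_smul, hs]

lemma grainCover_subset_univ (x : E) : grainCover s A x ⊆ grainCover s Set.univ x :=
  fun _ hz => ⟨trivial, hz.2⟩

lemma grainCover_univ_diff (x : E) :
    grainCover s Set.univ x \ grainCover s A x = grainCover s Aᶜ x := by
  ext z
  simp only [grainCover, Set.mem_sdiff, Set.mem_ofPred_eq, Set.mem_univ, Set.mem_compl_iff]
  tauto

lemma eventually_notMem_grainCover {x : E} {z : E × Compacts E} (hz : z.1 ≠ x) :
    ∀ᶠ s in 𝓝 (0 : ℝ), z ∉ grainCover s A x := by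
  obtain ⟨R, hR⟩ := z.2.isCompact.isBounded.exists_norm_le
  have hlim : Tendsto (fun s : ℝ => ‖s‖ * R) (𝓝 0) (𝓝 0) := by
    simpa using (tendsto_norm_zero (E := ℝ)).mul_const R
  filter_upwards [hlim.eventually_lt_const (norm_pos_iff.2 (sub_ne_zero.2 hz.symm))]
    with s hs hmem
  obtain ⟨u, hu, rfl⟩ := hmem.2
  rw [add_sub_cancel_left, norm_smul] at hs
  exact hs.not_ge (mul_le_mul_of_nonneg_left (hR u hu) (norm_nonneg s))

lemma isOpen_setOf_grain_inter_nonempty (s : ℝ) {U : Set E} (hU : IsOpen U) :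
    IsOpen {z : E × Compacts E | ((fun u => z.1 + s • u) '' (z.2 : Set E) ∩ U).Nonempty} := by
  have hcont : Continuous fun z : E × Compacts E => ({z.1} : Compacts E) ×ˢ z.2 :=
    Compacts.continuous_prod.comp
      ((Compacts.continuous_singleton.comp continuous_fst).prodMk continuous_snd)
  have hpre : IsOpen {p : E × E | p.1 + s • p.2 ∈ U} := hU.preimage (by fun_prop)
  convert (Compacts.isOpen_inter_nonempty_of_isOpen hpre).preimage hcont using 1
  ext z
  simp [Set.Nonempty, -SetLike.mem_coe]

lemma measurableSet_setOf_mem_closure {Ω X : Type*} [MeasurableSpace Ω] [TopologicalSpace X]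
    [SecondCountableTopology X] [MeasurableSpace X] [OpensMeasurableSpace X] {F : Ω → Set X}
    (hF : ∀ U, IsOpen U → MeasurableSet {ω | (F ω ∩ U).Nonempty}) :
    MeasurableSet {p : Ω × X | p.2 ∈ closure (F p.1)} := by
  have hbasis := isBasis_countableBasis X
  have heq : {p : Ω × X | p.2 ∈ closure (F p.1)}
      = ⋂ U ∈ countableBasis X, {ω | (F ω ∩ U).Nonempty} ×ˢ U ∪ Set.univ ×ˢ Uᶜ := by
    ext p
    simp only [Set.mem_ofPred_eq, hbasis.mem_closure_iff, Set.mem_iInter, Set.mem_union,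
      Set.mem_prod, Set.mem_univ, true_and, Set.mem_compl_iff, Set.inter_comm (F p.1)]
    exact forall₂_congr fun U _ => by tauto
  rw [heq]
  refine .biInter (countable_countableBasis X) fun U hU => ?_
  exact ((hF U (hbasis.isOpen hU)).prod (hbasis.isOpen hU).measurableSet).union
    (MeasurableSet.univ.prod (hbasis.isOpen hU).measurableSet.compl)

section Measurability

variable [MeasurableSpace E] [BorelSpace E] [SecondCountableTopology E]

lemma measurableSet_grainCover (hs : s ≠ 0) (hA : MeasurableSet A) :
    MeasurableSet {p : E × (E × Compacts E) | p.2 ∈ grainCover s A p.1} := by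
  simp_rw [mem_grainCover_iff hs]
  have hgrain : Measurable fun p : E × (E × Compacts E) => p.2.2 := by fun_prop
  have hpoint : Measurable fun p : E × (E × Compacts E) => (p.2.2, s⁻¹ • (p.1 - p.2.1)) := by
    fun_prop
  exact (hgrain hA).inter (hpoint measurableSet_setOf_mem_compacts)

lemma tendsto_measure_grainCover {Q : Measure (E × Compacts E)} [IsFiniteMeasure Q]
    {x : E} (hx : Q (Prod.fst ⁻¹' {x}) = 0) :
    Tendsto (fun s => Q (grainCover s Set.univ x)) (𝓝[≠] 0) (𝓝 0) := by
  have hmeas {s : ℝ} (hs : s ≠ 0) : MeasurableSet (grainCover s Set.univ x) :=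
    measurableSet_section (measurableSet_grainCover hs MeasurableSet.univ) x
  have hlim : Tendsto (fun s => ∫⁻ z, (grainCover s Set.univ x).indicator 1 z ∂Q) (𝓝[≠] 0)
      (𝓝 (∫⁻ _, 0 ∂Q)) := by
    refine tendsto_lintegral_filter_of_dominated_convergence 1
      ?_ (Eventually.of_forall fun s => ae_of_all _ (Set.indicator_le_self' (by simp))) (by simp) ?_
    · filter_upwards [self_mem_nhdsWithin] with s hs using measurable_one.indicator (hmeas hs)
    · filter_upwards [compl_mem_ae_iff.2 hx] with z hz
      refine tendsto_const_nhds.congr' (nhdsWithin_le_nhds ?_)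
      filter_upwards [eventually_notMem_grainCover (A := Set.univ) hz] with s hs
      exact (Set.indicator_of_notMem hs _).symm
  rw [lintegral_zero] at hlim
  refine hlim.congr' ?_
  filter_upwards [self_mem_nhdsWithin] with s hs using lintegral_indicator_one (hmeas hs)

theorem exists_isCoverage_grainCover {Ω : Type*} [MeasurableSpace Ω] {Pr : Measure Ω}
    {N : Ω → Set (E × Compacts E)} {M : ℝ} {Q : Measure (E × Compacts E)}
    (hN : HasPoissonLikeHits N M Q Pr) (s : ℝ) (hA : MeasurableSet A) :
    ∃ G, IsCoverage N (grainCover s A) G Pr := by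
  let F (ω : Ω) : Set E := {x | ω ∈ hitEvent N (grainCover s A x)}
  refine ⟨{p | p.2 ∈ closure (F p.1)}, measurableSet_setOf_mem_closure fun U hU => ?_, ?_⟩
  · let V := {z : E × Compacts E | ((fun u => z.1 + s • u) '' (z.2 : Set E) ∩ U).Nonempty}
    have hV : MeasurableSet (Prod.snd ⁻¹' A ∩ V) :=
      (measurable_snd hA).inter (isOpen_setOf_grain_inter_nonempty s hU).measurableSet
    convert hN.measurableSet_hit _ hV using 1
    ext ω
    constructor
    · rintro ⟨x, ⟨z, hzN, hzA, hzx⟩, hxU⟩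
      exact ⟨z, hzN, hzA, x, hzx, hxU⟩
    · rintro ⟨z, hzN, hzA, x, hzx, hxU⟩
      exact ⟨x, ⟨z, hzN, hzA, hzx⟩, hxU⟩
  · filter_upwards [hN.ae_finite] with ω hω x
    have hF : F ω = ⋃ z ∈ N ω ∩ Prod.snd ⁻¹' A, (fun u => z.1 + s • u) '' (z.2 : Set E) := by
      ext x
      simp only [F, hitEvent, grainCover, Set.Nonempty, Set.mem_ofPred_eq, Set.mem_inter_iff,
        Set.mem_iUnion, Set.mem_preimage, exists_prop, and_assoc]
    have hclosed : IsClosed (F ω) := by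
      rw [hF]
      exact (hω.inter_of_left _).isClosed_biUnion fun z _ =>
        (z.2.isCompact.image (by fun_prop)).isClosed
    exact iff_of_eq (congrArg (x ∈ ·) hclosed.closure_eq)

end Measurability

end Grains

section Density

/-- `κ` is a probability density function with respect to `volume`. -/
structure IsProbabilityDensity {X : Type*} [MeasureSpace X] (κ : X → ℝ) : Prop where
  measurable : Measurable κ
  nonneg : ∀ x, 0 ≤ κ x
  lintegral_eq_one : ∫⁻ x, ENNReal.ofReal (κ x) = 1

variable {X : Type*} [MeasureSpace X] {κ : X → ℝ}

lemma IsProbabilityDensity.lintegral_enorm (hκ : IsProbabilityDensity κ) : ∫⁻ x, ‖κ x‖ₑ = 1 := by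
  simp_rw [← hκ.lintegral_eq_one, Real.enorm_of_nonneg (hκ.nonneg _)]

lemma IsProbabilityDensity.integrable (hκ : IsProbabilityDensity κ) : Integrable κ :=
  ⟨hκ.measurable.aestronglyMeasurable, hκ.lintegral_enorm.trans_lt ENNReal.one_lt_top⟩

lemma IsProbabilityDensity.isProbabilityMeasure_withDensity (hκ : IsProbabilityDensity κ) :
    IsProbabilityMeasure (volume.withDensity fun x => ENNReal.ofReal (κ x)) :=
  ⟨by rw [withDensity_apply _ MeasurableSet.univ, Measure.restrict_univ, hκ.lintegral_eq_one]⟩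

end Density

section Intensity

section Law

variable {E : Type*} [TopologicalSpace E] [MeasureSpace E]

/-- The joint distribution of a germ with density `κ` and an independent grain with
distribution `μT`. -/
noncomputable def germGrainLaw (κ : E → ℝ) (μT : Measure (Compacts E)) :
    Measure (E × Compacts E) :=
  (volume.withDensity fun x => ENNReal.ofReal (κ x)).prod μT

/-- The `k`-th moment of the volume of a grain with distribution `μT`, restricted to the event that
the grain belongs to `A`. -/
noncomputable def grainMoment (μT : Measure (Compacts E)) (A : Set (Compacts E)) (k : ℕ) : ℝ≥0∞ :=
  ∫⁻ t in A, volume (t : Set E) ^ k ∂μT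

/-- The measure on pairs of a grain and one of its points, of total mass the mean volume of a
grain. -/
noncomputable def grainPointMeasure (μT : Measure (Compacts E)) : Measure (Compacts E × E) :=
  (μT.prod volume).restrict {p | p.2 ∈ p.1}

lemma IsProbabilityDensity.isProbabilityMeasure_germGrainLaw {κ : E → ℝ}
    {μT : Measure (Compacts E)} [IsProbabilityMeasure μT] (hκ : IsProbabilityDensity κ) :
    IsProbabilityMeasure (germGrainLaw κ μT) :=
  have := hκ.isProbabilityMeasure_withDensity
  inferInstanceAs (IsProbabilityMeasure (Measure.prod _ _))

end Law

variable {E : Type*} [NormedAddCommGroup E] [NormedSpace ℝ E] [MeasureSpace E] [BorelSpace E]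
  [FiniteDimensional ℝ E] [(volume : Measure E).IsAddHaarMeasure] {κ : E → ℝ}
  {μT : Measure (Compacts E)} {s : ℝ} {A : Set (Compacts E)}

open scoped Pointwise in
lemma volume_setOf_mem_grainCover (hs : 0 ≤ s) (z : E × Compacts E) :
    volume {x | z ∈ grainCover s A x} = (Prod.snd ⁻¹' A).indicator
      (fun z => ENNReal.ofReal (s ^ Module.finrank ℝ E) * volume (z.2 : Set E)) z := by
  by_cases hz : z.2 ∈ A
  · have himage : {x | z ∈ grainCover s A x} = (fun u => z.1 + u) '' (s • (z.2 : Set E)) := by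
      ext x
      simp only [grainCover, hz, true_and, Set.mem_ofPred_eq, ← Set.image_smul, Set.image_image]
    rw [Set.indicator_of_mem (Set.mem_preimage.2 hz), himage, Set.image_add_left,
      measure_preimage_add, Measure.addHaar_smul, abs_of_nonneg (by positivity)]
  · simp [grainCover, hz]

lemma lintegral_volume_setOf_mem_grainCover_pow {ρ : Measure E} [IsProbabilityMeasure ρ]
    [SFinite μT] (hs : 0 ≤ s) (hA : MeasurableSet A) {k : ℕ} (hk : k ≠ 0) :
    ∫⁻ z, volume {x | z ∈ grainCover s A x} ^ k ∂ρ.prod μT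
      = ENNReal.ofReal (s ^ Module.finrank ℝ E) ^ k * grainMoment μT A k := by
  have hvol : Measurable fun t : Compacts E =>
      (ENNReal.ofReal (s ^ Module.finrank ℝ E) * volume (t : Set E)) ^ k :=
    ((measurable_measure_compacts volume).const_mul _).pow_const k
  have hind (z : E × Compacts E) : volume {x | z ∈ grainCover s A x} ^ k
      = A.indicator (fun t : Compacts E =>
        (ENNReal.ofReal (s ^ Module.finrank ℝ E) * volume (t : Set E)) ^ k) z.2 := by
    rw [volume_setOf_mem_grainCover hs]
    by_cases hz : z.2 ∈ A <;> simp [hz, hk]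
  simp_rw [hind]
  rw [measurePreserving_snd.lintegral_comp (hvol.indicator hA), lintegral_indicator hA]
  simp_rw [mul_pow]
  exact lintegral_const_mul' _ _ (ENNReal.pow_ne_top ENNReal.ofReal_ne_top)

lemma lintegral_measure_grainCover {ρ : Measure E} [IsProbabilityMeasure ρ] [SFinite μT]
    (hs : 0 < s) (hA : MeasurableSet A) :
    ∫⁻ x, (ρ.prod μT) (grainCover s A x)
      = ENNReal.ofReal (s ^ Module.finrank ℝ E) * grainMoment μT A 1 := by
  rw [lintegral_measure_section (measurableSet_grainCover hs.ne' hA)]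
  simpa only [pow_one] using
    lintegral_volume_setOf_mem_grainCover_pow (ρ := ρ) hs.le hA one_ne_zero

lemma grainPointMeasure_univ :
    grainPointMeasure μT Set.univ = grainMoment μT Set.univ 1 := by
  rw [grainPointMeasure, Measure.restrict_apply_univ,
    Measure.prod_apply measurableSet_setOf_mem_compacts, grainMoment, Measure.restrict_univ]
  simp only [pow_one]
  rfl

lemma measure_grainCover_univ [SFinite μT] {h : E → ℝ≥0∞} (hh : Measurable h) (hs : 0 < s)
    (x : E) :
    ((volume.withDensity h).prod μT) (grainCover s Set.univ x)
      = ENNReal.ofReal (s ^ Module.finrank ℝ E)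
        * ∫⁻ p, h (x - s • p.2) ∂grainPointMeasure μT := by
  have hW := measurableSet_section (measurableSet_grainCover hs.ne' MeasurableSet.univ) x
  rw [Measure.prod_apply_symm hW, grainPointMeasure,
    ← lintegral_indicator measurableSet_setOf_mem_compacts, lintegral_prod _
      (Measurable.aemeasurable
        (Measurable.indicator (by fun_prop) measurableSet_setOf_mem_compacts)),
    ← lintegral_const_mul' _ _ ENNReal.ofReal_ne_top]
  refine lintegral_congr fun t => ?_
  have hW_t : MeasurableSet ((fun y => (y, t)) ⁻¹' grainCover s Set.univ x) :=
    measurable_prodMk_right hW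
  rw [withDensity_apply _ hW_t, ← lintegral_indicator hW_t,
    lintegral_eq_lintegral_sub_smul hs x (hh.indicator hW_t)]
  congr 1
  refine lintegral_congr fun u => ?_
  have hcover : x - s • u ∈ (fun y => (y, t)) ⁻¹' grainCover s Set.univ x ↔ u ∈ t := by
    simp [mem_grainCover_iff hs.ne', inv_smul_smul₀ hs.ne']
  by_cases hu : u ∈ t <;> simp [Set.indicator, hcover, hu]

lemma integrable_grainPointMeasure [IsFiniteMeasure μT] (hκ : IsProbabilityDensity κ)
    (hs : 0 < s) (x : E) : Integrable (fun p => κ (x - s • p.2)) (grainPointMeasure μT) := by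
  have hκ_meas := hκ.measurable
  have := hκ.isProbabilityMeasure_withDensity
  have hcover := measure_grainCover_univ (μT := μT) hκ_meas.ennreal_ofReal hs x
  refine ⟨Measurable.aestronglyMeasurable (by fun_prop), ?_⟩
  simp_rw [HasFiniteIntegral, Real.enorm_of_nonneg (hκ.nonneg _)]
  refine lt_top_iff_ne_top.2 fun htop => ?_
  rw [htop, ENNReal.mul_top (by positivity)] at hcover
  exact measure_ne_top _ _ hcover

lemma measureReal_grainCover_univ [IsFiniteMeasure μT] (hκ : IsProbabilityDensity κ) (hs : 0 < s)
    (x : E) :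
    (germGrainLaw κ μT).real (grainCover s Set.univ x)
      = s ^ Module.finrank ℝ E * ∫ p, κ (x - s • p.2) ∂grainPointMeasure μT := by
  rw [measureReal_def, germGrainLaw, measure_grainCover_univ hκ.measurable.ennreal_ofReal hs,
    ENNReal.toReal_mul, ENNReal.toReal_ofReal (by positivity),
    integral_eq_lintegral_of_nonneg_ae (ae_of_all _ fun _ => hκ.nonneg _)
      (integrable_grainPointMeasure hκ hs x).1]

lemma enorm_mul_measureReal_grainCover_sub_le [IsFiniteMeasure μT] (hκ : IsProbabilityDensity κ)
    (hm : grainMoment μT Set.univ 1 ≠ ∞) (hs : 0 < s) (M : ℝ) (x : E) :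
    ‖M * (germGrainLaw κ μT).real (grainCover s Set.univ x)
        - κ x * (grainMoment μT Set.univ 1).toReal‖ₑ
      ≤ ‖M * s ^ Module.finrank ℝ E - 1‖ₑ * ∫⁻ p, ‖κ (x - s • p.2)‖ₑ ∂grainPointMeasure μT
        + ∫⁻ p, ‖κ (x - s • p.2) - κ x‖ₑ ∂grainPointMeasure μT := by
  have : IsFiniteMeasure (grainPointMeasure μT) :=
    ⟨by rw [grainPointMeasure_univ]; exact hm.lt_top⟩
  have hsplit : M * (germGrainLaw κ μT).real (grainCover s Set.univ x)
      - κ x * (grainMoment μT Set.univ 1).toReal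
      = (M * s ^ Module.finrank ℝ E - 1) * ∫ p, κ (x - s • p.2) ∂grainPointMeasure μT
        + ∫ p, (κ (x - s • p.2) - κ x) ∂grainPointMeasure μT := by
    rw [measureReal_grainCover_univ hκ hs, integral_sub (integrable_grainPointMeasure hκ hs x)
      (integrable_const _), integral_const, measureReal_def, grainPointMeasure_univ, smul_eq_mul]
    ring
  rw [hsplit]
  refine (enorm_add_le _ _).trans (add_le_add ?_ (enorm_integral_le_lintegral_enorm _))
  rw [enorm_mul]
  exact mul_le_mul' le_rfl (enorm_integral_le_lintegral_enorm _)

lemma tendsto_lintegral_enorm_sub_smul_sub (hκ : IsProbabilityDensity κ)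
    (hm : grainMoment μT Set.univ 1 ≠ ∞) :
    Tendsto (fun s : ℝ => ∫⁻ p, (∫⁻ x, ‖κ (x - s • p.2) - κ x‖ₑ) ∂grainPointMeasure μT)
      (𝓝 0) (𝓝 0) := by
  have hκ_meas := hκ.measurable
  simp_rw [sub_eq_neg_add (_ : E) (_ • _)]
  rw [← lintegral_zero (μ := grainPointMeasure μT)]
  refine tendsto_lintegral_filter_of_dominated_convergence (fun _ => 2)
    (Eventually.of_forall fun s => ?_) (Eventually.of_forall fun s => ae_of_all _ fun p => ?_) ?_
    (ae_of_all _ fun p => ?_)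
  · exact Measurable.lintegral_prod_right' (f := fun q : (Compacts E × E) × E =>
      ‖κ (-(s • q.1.2) + q.2) - κ q.2‖ₑ) (by fun_prop)
  · simpa [hκ.lintegral_enorm] using
      lintegral_enorm_translate_sub_le hκ.integrable.1 (-(s • p.2))
  · rw [lintegral_const, grainPointMeasure_univ]
    finiteness
  · have hshift : Tendsto (fun s : ℝ => -(s • p.2)) (𝓝 0) (𝓝 0) :=
      Continuous.tendsto' (by fun_prop) _ _ (by simp)
    exact (tendsto_lintegral_enorm_translate_sub hκ.integrable).comp hshift

lemma lintegral_enorm_mul_measureReal_grainCover_sub_le [IsFiniteMeasure μT]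
    (hκ : IsProbabilityDensity κ) (hm : grainMoment μT Set.univ 1 ≠ ∞) (hs : 0 < s) (M : ℝ) :
    ∫⁻ x, ‖M * (germGrainLaw κ μT).real (grainCover s Set.univ x)
        - κ x * (grainMoment μT Set.univ 1).toReal‖ₑ
      ≤ ‖M * s ^ Module.finrank ℝ E - 1‖ₑ * grainMoment μT Set.univ 1
        + ∫⁻ p, (∫⁻ x, ‖κ (x - s • p.2) - κ x‖ₑ) ∂grainPointMeasure μT := by
  have hκ_meas := hκ.measurable
  have : IsFiniteMeasure (grainPointMeasure μT) :=
    ⟨by rw [grainPointMeasure_univ]; exact hm.lt_top⟩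
  refine (lintegral_mono fun x => enorm_mul_measureReal_grainCover_sub_le hκ hm hs M x).trans_eq ?_
  have hmeas : Measurable fun x => ∫⁻ p, ‖κ (x - s • p.2)‖ₑ ∂grainPointMeasure μT :=
    Measurable.lintegral_prod_right'
      (f := fun q : E × Compacts E × E => ‖κ (q.1 - s • q.2.2)‖ₑ) (by fun_prop)
  rw [lintegral_add_left (hmeas.const_mul _), lintegral_const_mul _ hmeas,
    lintegral_lintegral_swap (f := fun x (p : Compacts E × E) => ‖κ (x - s • p.2)‖ₑ) (by fun_prop),
    lintegral_lintegral_swap (f := fun x (p : Compacts E × E) => ‖κ (x - s • p.2) - κ x‖ₑ)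
      (by fun_prop)]
  have hmass (v : E) : ∫⁻ x, ‖κ (x - v)‖ₑ = 1 :=
    (lintegral_sub_right_eq_self (fun x => ‖κ x‖ₑ) v).trans hκ.lintegral_enorm
  simp_rw [hmass]
  rw [lintegral_one, grainPointMeasure_univ]

lemma tendsto_lintegral_mul_measure_grainCover [Nontrivial E] [IsProbabilityMeasure μT]
    (hκ : IsProbabilityDensity κ) {h : E → ℝ≥0∞} (hh : Measurable h) (hh_fin : ∫⁻ x, h x ≠ ∞) :
    Tendsto (fun s => ∫⁻ x, h x * germGrainLaw κ μT (grainCover s Set.univ x)) (𝓝[≠] 0)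
      (𝓝 0) := by
  have := hκ.isProbabilityMeasure_germGrainLaw (μT := μT)
  have hnull (x : E) : germGrainLaw κ μT (Prod.fst ⁻¹' {x}) = 0 := by
    rw [germGrainLaw, ← Set.prod_univ, Measure.prod_prod, withDensity_absolutelyContinuous _ _
      (measure_singleton x), zero_mul]
  rw [← lintegral_zero (μ := (volume : Measure E))]
  refine tendsto_lintegral_filter_of_dominated_convergence h ?_
    (Eventually.of_forall fun s => ae_of_all _ fun x => mul_le_of_le_one_right' prob_le_one)
    hh_fin ?_
  · filter_upwards [self_mem_nhdsWithin] with s hs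
    exact hh.mul (measurable_measure_section (measurableSet_grainCover hs MeasurableSet.univ))
  · filter_upwards [ae_lt_top hh hh_fin] with x hx
    simpa only [mul_zero] using
      ENNReal.Tendsto.const_mul (tendsto_measure_grainCover (hnull x)) (.inr hx.ne)

end Intensity

section Limits

variable {E : Type*} [NormedAddCommGroup E] [NormedSpace ℝ E] [MeasureSpace E]
  [FiniteDimensional ℝ E] {κ : E → ℝ} {μT : Measure (Compacts E)} {A : Set (Compacts E)}

/-- The bound, for intensity `M` and grains scaled by `s`, on the distance between the expected
integral over the covered set and its limit. -/
noncomputable def meanError (κ : E → ℝ) (μT : Measure (Compacts E)) (s M : ℝ) : ℝ≥0∞ :=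
  2 * (∫⁻ x, ‖M * (germGrainLaw κ μT).real (grainCover s Set.univ x)
      - κ x * (grainMoment μT Set.univ 1).toReal‖ₑ)
    + ∫⁻ x, ENNReal.ofReal (κ x * (grainMoment μT Set.univ 1).toReal)
      * germGrainLaw κ μT (grainCover s Set.univ x)

/-- The bound, for intensity `M` and grains in `A` scaled by `s`, on the standard deviation of the
integral over the covered set. -/
noncomputable def deviationBound (μT : Measure (Compacts E)) (A : Set (Compacts E)) (s M : ℝ) :
    ℝ≥0∞ :=
  (ENNReal.ofReal M * (ENNReal.ofReal (s ^ Module.finrank ℝ E) ^ 2 * grainMoment μT A 2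
    + (ENNReal.ofReal (s ^ Module.finrank ℝ E) * grainMoment μT A 1) ^ 2)) ^ (1 / 2 : ℝ)

variable [Nontrivial E] {ι : Type*} {L : Filter ι} {s M : ι → ℝ}

theorem tendsto_deviationBound (hm : grainMoment μT A 1 ≠ ∞) (hm_two : grainMoment μT A 2 ≠ ∞)
    (hs : Tendsto s L (𝓝[>] 0))
    (hM : Tendsto (fun i => M i * s i ^ Module.finrank ℝ E) L (𝓝 1)) :
    Tendsto (fun i => deviationBound μT A (s i) (M i)) L (𝓝 0) := by
  have hpow : Tendsto (fun i => s i ^ Module.finrank ℝ E) L (𝓝 0) := by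
    simpa [Module.finrank_pos.ne'] using
      (hs.mono_right nhdsWithin_le_nhds).pow (Module.finrank ℝ E)
  have hscale := ENNReal.Tendsto.mul_const (b := grainMoment μT A 2 + grainMoment μT A 1 ^ 2)
    (ENNReal.tendsto_ofReal (hM.mul hpow)) (.inr (by finiteness))
  rw [mul_zero, ENNReal.ofReal_zero, zero_mul] at hscale
  have hroot := hscale.ennrpow_const (1 / 2 : ℝ)
  rw [ENNReal.zero_rpow_of_pos (by norm_num)] at hroot
  refine hroot.congr' ?_
  filter_upwards [hs.eventually self_mem_nhdsWithin] with i hi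
  have hi_pow : 0 ≤ s i ^ Module.finrank ℝ E := pow_nonneg (le_of_lt hi) _
  rw [deviationBound, ENNReal.ofReal_mul' hi_pow, ENNReal.ofReal_mul' hi_pow]
  ring_nf

variable [BorelSpace E] [(volume : Measure E).IsAddHaarMeasure]

theorem tendsto_meanError [IsProbabilityMeasure μT] (hκ : IsProbabilityDensity κ)
    (hm : grainMoment μT Set.univ 1 ≠ ∞) (hs : Tendsto s L (𝓝[>] 0))
    (hM : Tendsto (fun i => M i * s i ^ Module.finrank ℝ E) L (𝓝 1)) :
    Tendsto (fun i => meanError κ μT (s i) (M i)) L (𝓝 0) := by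
  have hscale : Tendsto (fun i => ‖M i * s i ^ Module.finrank ℝ E - 1‖ₑ) L (𝓝 0) := by
    simpa using (hM.sub_const 1).enorm
  have hsmooth := (tendsto_lintegral_enorm_sub_smul_sub hκ hm).comp
    (hs.mono_right nhdsWithin_le_nhds)
  have hbound := (ENNReal.Tendsto.mul_const hscale (.inr hm)).add hsmooth
  rw [zero_mul, add_zero] at hbound
  have hlinear := tendsto_of_tendsto_of_tendsto_of_le_of_le' tendsto_const_nhds hbound
    (Eventually.of_forall fun _ => zero_le) <| by
      filter_upwards [hs.eventually self_mem_nhdsWithin] with i hi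
      exact lintegral_enorm_mul_measureReal_grainCover_sub_le hκ hm hi (M i)
  have hlimit_fin :
      ∫⁻ x, ENNReal.ofReal (κ x * (grainMoment μT Set.univ 1).toReal) ≠ ∞ :=
    (hκ.integrable.mul_const _).lintegral_lt_top.ne
  have hsquare := (tendsto_lintegral_mul_measure_grainCover (μT := μT) hκ
    (hκ.measurable.mul_const _).ennreal_ofReal hlimit_fin).comp
    (hs.mono_right (nhdsWithin_mono 0 fun _ hx => ne_of_gt (Set.mem_Ioi.1 hx)))
  simpa [meanError, Function.comp_def] using
    (ENNReal.Tendsto.const_mul (a := 2) hlinear (.inr ENNReal.ofNat_ne_top)).add hsquare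

end Limits

section Truncation

variable {α : Type*} [TopologicalSpace α] [MeasureSpace α] {μT : Measure (Compacts α)}

lemma grainMoment_mono {A B : Set (Compacts α)} (hAB : A ⊆ B) (k : ℕ) :
    grainMoment μT A k ≤ grainMoment μT B k :=
  lintegral_mono_set hAB

lemma grainMoment_univ_ne_top_of_le [IsFiniteMeasure μT] {k : ℕ} {p : ℝ} (hk : (k : ℝ) ≤ p)
    (hp : ∫⁻ t : Compacts α, volume (t : Set α) ^ p ∂μT ≠ ∞) :
    grainMoment μT Set.univ k ≠ ∞ := by
  have hle : grainMoment μT Set.univ k ≤ ∫⁻ t : Compacts α, (1 + volume (t : Set α) ^ p) ∂μT := by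
    rw [grainMoment, Measure.restrict_univ]
    refine lintegral_mono fun t => ?_
    rcases le_total (volume (t : Set α)) 1 with h | h
    · exact (pow_le_one₀ zero_le h).trans le_self_add
    · rw [← ENNReal.rpow_natCast]
      exact (ENNReal.rpow_le_rpow_of_exponent_le h hk).trans le_add_self
  refine ne_top_of_le_ne_top ?_ hle
  rw [lintegral_add_left measurable_const]
  simpa using hp

variable [T2Space α] [SecondCountableTopology α] [BorelSpace α] [SFinite (volume : Measure α)]

lemma measurableSet_setOf_volume_le (K : ℝ≥0∞) :
    MeasurableSet {t : Compacts α | volume (t : Set α) ≤ K} :=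
  measurableSet_le (measurable_measure_compacts volume) measurable_const

lemma grainMoment_two_setOf_volume_le_ne_top (hm : grainMoment μT Set.univ 1 ≠ ∞) {K : ℝ≥0∞}
    (hK : K ≠ ∞) : grainMoment μT {t | volume (t : Set α) ≤ K} 2 ≠ ∞ := by
  refine ne_top_of_le_ne_top (ENNReal.mul_ne_top hK hm) ?_
  calc grainMoment μT {t | volume (t : Set α) ≤ K} 2
      ≤ ∫⁻ t in {t | volume (t : Set α) ≤ K}, K * volume (t : Set α) ^ 1 ∂μT := by
        refine setLIntegral_mono' (measurableSet_setOf_volume_le K) fun t ht => ?_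
        rw [sq, pow_one]
        exact mul_le_mul_left ht _
    _ = K * grainMoment μT {t | volume (t : Set α) ≤ K} 1 := lintegral_const_mul' _ _ hK
    _ ≤ K * grainMoment μT Set.univ 1 := mul_le_mul' le_rfl (grainMoment_mono (Set.subset_univ _) 1)

lemma tendsto_grainMoment_compl_setOf_volume_le [IsFiniteMeasureOnCompacts (volume : Measure α)]
    (hm : grainMoment μT Set.univ 1 ≠ ∞) :
    Tendsto (fun K : ℕ => grainMoment μT {t | volume (t : Set α) ≤ K}ᶜ 1) atTop (𝓝 0) := by
  have hempty : ⋂ K : ℕ, {t : Compacts α | volume (t : Set α) ≤ K}ᶜ = ∅ := by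
    refine Set.eq_empty_of_forall_notMem fun t ht => ?_
    obtain ⟨K, hK⟩ := ENNReal.exists_nat_gt (t.isCompact.measure_lt_top (μ := volume)).ne
    exact Set.mem_iInter.1 ht K hK.le
  have hanti : Antitone fun K : ℕ => {t : Compacts α | volume (t : Set α) ≤ K}ᶜ :=
    fun K K' hK => Set.compl_subset_compl.2 fun t (ht : volume (t : Set α) ≤ K) =>
      ht.trans (Nat.cast_le.2 hK)
  have hmeas (K : ℕ) := (measurableSet_setOf_volume_le (α := α) K).compl
  have hlim := tendsto_measure_iInter_atTop
    (μ := μT.withDensity fun t => volume (t : Set α) ^ 1)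
    (fun K => (hmeas K).nullMeasurableSet) hanti ⟨0, ?_⟩
  · rw [hempty, measure_empty] at hlim
    exact hlim.congr fun K => withDensity_apply _ (hmeas K)
  · rw [withDensity_apply _ (hmeas 0)]
    exact ne_top_of_le_ne_top hm (grainMoment_mono (Set.subset_univ _) 1)

end Truncation

section LqConvergence

variable {Ω : Type*} [MeasurableSpace Ω] {Pr : Measure Ω} [IsProbabilityMeasure Pr]

lemma eLpNorm_one_sub_integral_le {Z Z' : Ω → ℝ} (hZ : Integrable Z Pr) (hZ' : Integrable Z' Pr) :
    eLpNorm (fun ω => Z ω - ∫ ω', Z ω' ∂Pr) 1 Pr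
      ≤ 2 * eLpNorm (Z - Z') 1 Pr + eLpNorm (fun ω => Z' ω - ∫ ω', Z' ω' ∂Pr) 2 Pr := by
  have hsub := hZ.1.sub hZ'.1
  have hcenter : AEStronglyMeasurable (fun ω => Z' ω - ∫ ω', Z' ω' ∂Pr) Pr :=
    hZ'.1.sub aestronglyMeasurable_const
  have hconst : AEStronglyMeasurable (fun _ : Ω => ∫ ω, (Z' - Z) ω ∂Pr) Pr :=
    aestronglyMeasurable_const
  have hsplit : (fun ω => Z ω - ∫ ω', Z ω' ∂Pr)
      = (Z - Z') + ((fun ω => Z' ω - ∫ ω', Z' ω' ∂Pr) + fun _ => ∫ ω, (Z' - Z) ω ∂Pr) := by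
    ext ω
    simp only [Pi.add_apply, Pi.sub_apply, integral_sub hZ' hZ]
    ring
  have hmean : eLpNorm (fun _ : Ω => ∫ ω, (Z' - Z) ω ∂Pr) 1 Pr ≤ eLpNorm (Z - Z') 1 Pr := by
    rw [eLpNorm_const _ one_ne_zero (NeZero.ne Pr), measure_univ, ENNReal.one_rpow, mul_one,
      eLpNorm_sub_comm, eLpNorm_one_eq_lintegral_enorm]
    exact enorm_integral_le_lintegral_enorm _
  rw [hsplit]
  calc _ ≤ eLpNorm (Z - Z') 1 Pr + (eLpNorm (fun ω => Z' ω - ∫ ω', Z' ω' ∂Pr) 1 Pr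
          + eLpNorm (fun _ : Ω => ∫ ω, (Z' - Z) ω ∂Pr) 1 Pr) :=
        (eLpNorm_add_le hsub (hcenter.add hconst) le_rfl).trans
          (add_le_add le_rfl (eLpNorm_add_le hcenter hconst le_rfl))
    _ ≤ eLpNorm (Z - Z') 1 Pr + (eLpNorm (fun ω => Z' ω - ∫ ω', Z' ω' ∂Pr) 2 Pr
          + eLpNorm (Z - Z') 1 Pr) := by
        gcongr
        exact eLpNorm_le_eLpNorm_of_exponent_le one_le_two hcenter
    _ = _ := by ring

lemma convergesInLq_of_tendsto_eLpNorm_sub_integral {ι : Type*} {L : Filter ι} {F : ι → Ω → ℝ}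
    {c : ℝ} {q : ℝ≥0∞} (hq : 1 ≤ q) (hF : ∀ᶠ i in L, AEStronglyMeasurable (F i) Pr)
    (hdev : Tendsto (fun i => eLpNorm (fun ω => F i ω - ∫ ω', F i ω' ∂Pr) q Pr) L (𝓝 0))
    (hmean : Tendsto (fun i => ∫ ω, F i ω ∂Pr) L (𝓝 c)) : ConvergesInLq F L c q Pr := by
  have hmean_sub : Tendsto (fun i => ‖∫ ω, F i ω ∂Pr - c‖ₑ) L (𝓝 0) := by
    simpa using (hmean.sub_const c).enorm
  have hbound := hdev.add hmean_sub
  rw [add_zero] at hbound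
  have hlim : Tendsto (fun i => eLpNorm (fun ω => F i ω - c) q Pr) L (𝓝 0) := by
    refine tendsto_of_tendsto_of_tendsto_of_le_of_le' tendsto_const_nhds hbound
      (Eventually.of_forall fun _ => zero_le) ?_
    filter_upwards [hF] with i hi
    have hsplit : (fun ω => F i ω - c) = (fun ω => F i ω - ∫ ω', F i ω' ∂Pr)
        + fun _ => ∫ ω, F i ω ∂Pr - c := by
      ext ω
      simp only [Pi.add_apply]
      ring
    rw [hsplit]
    refine (eLpNorm_add_le (hi.sub aestronglyMeasurable_const) aestronglyMeasurable_const
      hq).trans_eq ?_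
    rw [eLpNorm_const _ (one_pos.trans_le hq).ne' (NeZero.ne Pr), measure_univ, ENNReal.one_rpow,
      mul_one]
    rfl
  refine ⟨?_, hlim⟩
  filter_upwards [hF, hlim.eventually_lt_const ENNReal.zero_lt_top] with i hi hi_lt
  have hmemLp : MemLp (fun ω => F i ω - c) q Pr := ⟨hi.sub aestronglyMeasurable_const, hi_lt⟩
  exact (hmemLp.add (memLp_const c)).ae_eq (ae_of_all _ fun ω => sub_add_cancel (F i ω) c)

end LqConvergence

section CoveredIntegral

/-- The integral of `f` over the random set of all `x` such that `N` hits `W x`. -/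
noncomputable def coveredIntegral {Ω E S : Type*} [MeasurableSpace E] (ν : Measure E) (f : E → ℝ)
    (N : Ω → Set S) (W : E → Set S) (ω : Ω) : ℝ :=
  ∫ x in {x | ω ∈ hitEvent N (W x)}, f x ∂ν

lemma IsCoverage.sectionIntegral_ae_eq {Ω E S : Type*} [MeasurableSpace Ω] [MeasurableSpace E]
    {N : Ω → Set S} {W : E → Set S} {G : Set (Ω × E)} {Pr : Measure Ω}
    (hG : IsCoverage N W G Pr) (ν : Measure E) (f : E → ℝ) :
    sectionIntegral ν f G =ᵐ[Pr] coveredIntegral ν f N W := by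
  filter_upwards [hG.ae_mem_iff] with ω hω
  simp only [sectionIntegral, coveredIntegral, hω]

variable {E : Type*} [NormedAddCommGroup E] [NormedSpace ℝ E] [MeasureSpace E] [BorelSpace E]
  [FiniteDimensional ℝ E] [(volume : Measure E).IsAddHaarMeasure] {κ : E → ℝ}
  {μT : Measure (Compacts E)} {A : Set (Compacts E)} {f : E → ℝ} {C : ℝ≥0}
  {Ω : Type*} [MeasurableSpace Ω] {Pr : Measure Ω}

section Estimates

variable {N : Ω → Set (E × Compacts E)} {s M : ℝ}

lemma lintegral_germGrainLaw_grainCover [SFinite μT] (hκ : IsProbabilityDensity κ) (hs : 0 < s)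
    (hA : MeasurableSet A) :
    ∫⁻ x, germGrainLaw κ μT (grainCover s A x)
      = ENNReal.ofReal (s ^ Module.finrank ℝ E) * grainMoment μT A 1 :=
  have := hκ.isProbabilityMeasure_withDensity
  lintegral_measure_grainCover hs hA

lemma lintegral_germGrainLaw_grainCover_ne_top [SFinite μT] (hκ : IsProbabilityDensity κ)
    (hs : 0 < s) (hA : MeasurableSet A) (hm : grainMoment μT Set.univ 1 ≠ ∞) :
    ∫⁻ x, germGrainLaw κ μT (grainCover s A x) ≠ ∞ := by
  rw [lintegral_germGrainLaw_grainCover hκ hs hA]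
  exact ENNReal.mul_ne_top ENNReal.ofReal_ne_top
    (ne_top_of_le_ne_top hm (grainMoment_mono (Set.subset_univ A) 1))

lemma HasPoissonLikeHits.aestronglyMeasurable_coveredIntegral {Q : Measure (E × Compacts E)}
    (hN : HasPoissonLikeHits N M Q Pr) (s : ℝ) (hA : MeasurableSet A) (hf : Measurable f) :
    AEStronglyMeasurable (coveredIntegral volume f N (grainCover s A)) Pr := by
  obtain ⟨G, hG⟩ := exists_isCoverage_grainCover hN s hA
  exact (stronglyMeasurable_sectionIntegral hG.measurableSet hf).aestronglyMeasurable.congr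
    (hG.sectionIntegral_ae_eq volume f)

variable [IsProbabilityMeasure Pr] [IsProbabilityMeasure μT]

lemma HasPoissonLikeHits.integrable_coveredIntegral (hκ : IsProbabilityDensity κ)
    (hN : HasPoissonLikeHits N M (germGrainLaw κ μT) Pr) (hs : 0 < s) (hA : MeasurableSet A)
    (hm : grainMoment μT Set.univ 1 ≠ ∞) (hf : Measurable f) (hC : ∀ x, ‖f x‖₊ ≤ C) :
    Integrable (coveredIntegral volume f N (grainCover s A)) Pr := by
  have := hκ.isProbabilityMeasure_germGrainLaw (μT := μT)
  obtain ⟨G, hG⟩ := exists_isCoverage_grainCover hN s hA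
  have hG_fin := hG.prod_ne_top (ν := volume) hN (measurableSet_grainCover hs.ne' hA)
    (lintegral_germGrainLaw_grainCover_ne_top hκ hs hA hm)
  exact (integrable_sectionIntegral hG.measurableSet hf hC hG_fin).congr
    (hG.sectionIntegral_ae_eq volume f)

theorem HasPoissonLikeHits.eLpNorm_one_coveredIntegral_sub_le (hκ : IsProbabilityDensity κ)
    (hN : HasPoissonLikeHits N M (germGrainLaw κ μT) Pr) (hs : 0 < s) (hA : MeasurableSet A)
    (hm : grainMoment μT Set.univ 1 ≠ ∞) (hf : Measurable f) (hC : ∀ x, ‖f x‖₊ ≤ C) :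
    eLpNorm (coveredIntegral volume f N (grainCover s Set.univ)
        - coveredIntegral volume f N (grainCover s A)) 1 Pr
      ≤ C * (ENNReal.ofReal (M * s ^ Module.finrank ℝ E) * grainMoment μT Aᶜ 1) := by
  have := hκ.isProbabilityMeasure_germGrainLaw (μT := μT)
  obtain ⟨G, hG⟩ := exists_isCoverage_grainCover hN s MeasurableSet.univ
  obtain ⟨G', hG'⟩ := exists_isCoverage_grainCover hN s hA
  have hbound := hG.eLpNorm_one_sectionIntegral_sub_le (ν := volume) hG' hN
    (measurableSet_grainCover hs.ne' MeasurableSet.univ) (measurableSet_grainCover hs.ne' hA)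
    grainCover_subset_univ (lintegral_germGrainLaw_grainCover_ne_top hκ hs .univ hm) hf hC
  simp_rw [grainCover_univ_diff] at hbound
  rwa [lintegral_germGrainLaw_grainCover hκ hs hA.compl, ← mul_assoc (ENNReal.ofReal M),
    ← ENNReal.ofReal_mul hN.intensity_nonneg, eLpNorm_congr_ae
      ((hG.sectionIntegral_ae_eq volume f).sub (hG'.sectionIntegral_ae_eq volume f))] at hbound

theorem HasPoissonLikeHits.eLpNorm_two_coveredIntegral_sub_integral_le
    (hκ : IsProbabilityDensity κ) (hN : HasPoissonLikeHits N M (germGrainLaw κ μT) Pr)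
    (hs : 0 < s) (hA : MeasurableSet A) (hm : grainMoment μT Set.univ 1 ≠ ∞)
    (hm_two : grainMoment μT A 2 ≠ ∞) (hf : Measurable f) (hC : ∀ x, ‖f x‖₊ ≤ C) :
    eLpNorm (fun ω => coveredIntegral volume f N (grainCover s A) ω
        - ∫ ω', coveredIntegral volume f N (grainCover s A) ω' ∂Pr) 2 Pr
      ≤ C * deviationBound μT A s M := by
  have := hκ.isProbabilityMeasure_withDensity
  have := hκ.isProbabilityMeasure_germGrainLaw (μT := μT)
  obtain ⟨G, hG⟩ := exists_isCoverage_grainCover hN s hA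
  have hsquare : ∫⁻ z, volume {x | z ∈ grainCover s A x} ^ 2 ∂germGrainLaw κ μT
      = ENNReal.ofReal (s ^ Module.finrank ℝ E) ^ 2 * grainMoment μT A 2 :=
    lintegral_volume_setOf_mem_grainCover_pow hs.le hA two_ne_zero
  have hbound := hG.eLpNorm_two_sectionIntegral_sub_integral_le hN
    (measurableSet_grainCover hs.ne' hA) (lintegral_germGrainLaw_grainCover_ne_top hκ hs hA hm)
    (by rw [hsquare]; finiteness) hf hC
  have hae := hG.sectionIntegral_ae_eq volume f
  rw [← integral_congr_ae hae]
  refine (eLpNorm_congr_ae (hae.symm.sub EventuallyEq.rfl)).trans_le ?_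
  rwa [hsquare, lintegral_germGrainLaw_grainCover hκ hs hA] at hbound

theorem HasPoissonLikeHits.enorm_integral_coveredIntegral_sub_le (hκ : IsProbabilityDensity κ)
    (hN : HasPoissonLikeHits N M (germGrainLaw κ μT) Pr) (hs : 0 < s)
    (hm : grainMoment μT Set.univ 1 ≠ ∞) (hf : Measurable f) (hC : ∀ x, ‖f x‖₊ ≤ C) :
    ‖∫ ω, coveredIntegral volume f N (grainCover s Set.univ) ω ∂Pr
        - ∫ x, f x * (1 - Real.exp (-(κ x * (grainMoment μT Set.univ 1).toReal)))‖ₑ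
      ≤ C * meanError κ μT s M := by
  have := hκ.isProbabilityMeasure_germGrainLaw (μT := μT)
  obtain ⟨G, hG⟩ := exists_isCoverage_grainCover hN s MeasurableSet.univ
  rw [← integral_congr_ae (hG.sectionIntegral_ae_eq volume f)]
  exact hG.enorm_integral_sectionIntegral_sub_le hN
    (measurableSet_grainCover hs.ne' MeasurableSet.univ)
    (lintegral_germGrainLaw_grainCover_ne_top hκ hs .univ hm) hf hC
    (fun x => mul_nonneg (hκ.nonneg x) ENNReal.toReal_nonneg) (hκ.integrable.mul_const _)

end Estimates

variable [Nontrivial E] [IsProbabilityMeasure Pr] [IsProbabilityMeasure μT] {ι : Type*}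
  {L : Filter ι} {N : ι → Ω → Set (E × Compacts E)} {s M : ι → ℝ}

theorem tendsto_integral_coveredIntegral (hκ : IsProbabilityDensity κ)
    (hm : grainMoment μT Set.univ 1 ≠ ∞) (hf : Measurable f) (hC : ∀ x, ‖f x‖₊ ≤ C)
    (hN : ∀ᶠ i in L, HasPoissonLikeHits (N i) (M i) (germGrainLaw κ μT) Pr)
    (hs : Tendsto s L (𝓝[>] 0))
    (hM : Tendsto (fun i => M i * s i ^ Module.finrank ℝ E) L (𝓝 1)) :
    Tendsto (fun i => ∫ ω, coveredIntegral volume f (N i) (grainCover (s i) Set.univ) ω ∂Pr) L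
      (𝓝 (∫ x, f x * (1 - Real.exp (-(κ x * (grainMoment μT Set.univ 1).toReal))))) := by
  have herror := ENNReal.Tendsto.const_mul (a := (C : ℝ≥0∞)) (tendsto_meanError hκ hm hs hM)
    (.inr ENNReal.coe_ne_top)
  rw [mul_zero] at herror
  rw [tendsto_iff_edist_tendsto_0]
  refine tendsto_of_tendsto_of_tendsto_of_le_of_le' tendsto_const_nhds herror
    (Eventually.of_forall fun _ => zero_le) ?_
  filter_upwards [hN, hs.eventually self_mem_nhdsWithin] with i hNi hsi
  rw [edist_eq_enorm_sub]
  exact hNi.enorm_integral_coveredIntegral_sub_le hκ hsi hm hf hC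

theorem tendsto_eLpNorm_two_coveredIntegral_sub_integral (hκ : IsProbabilityDensity κ)
    (hA : MeasurableSet A) (hm : grainMoment μT Set.univ 1 ≠ ∞) (hm_two : grainMoment μT A 2 ≠ ∞)
    (hf : Measurable f) (hC : ∀ x, ‖f x‖₊ ≤ C)
    (hN : ∀ᶠ i in L, HasPoissonLikeHits (N i) (M i) (germGrainLaw κ μT) Pr)
    (hs : Tendsto s L (𝓝[>] 0))
    (hM : Tendsto (fun i => M i * s i ^ Module.finrank ℝ E) L (𝓝 1)) :
    Tendsto (fun i => eLpNorm (fun ω => coveredIntegral volume f (N i) (grainCover (s i) A) ω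
      - ∫ ω', coveredIntegral volume f (N i) (grainCover (s i) A) ω' ∂Pr) 2 Pr) L (𝓝 0) := by
  have hbound := ENNReal.Tendsto.const_mul (a := (C : ℝ≥0∞))
    (tendsto_deviationBound (ne_top_of_le_ne_top hm (grainMoment_mono (Set.subset_univ A) 1))
      hm_two hs hM) (.inr ENNReal.coe_ne_top)
  rw [mul_zero] at hbound
  refine tendsto_of_tendsto_of_tendsto_of_le_of_le' tendsto_const_nhds hbound
    (Eventually.of_forall fun _ => zero_le) ?_
  filter_upwards [hN, hs.eventually self_mem_nhdsWithin] with i hNi hsi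
  exact hNi.eLpNorm_two_coveredIntegral_sub_integral_le hκ hsi hA hm hm_two hf hC

theorem tendsto_eLpNorm_one_coveredIntegral_sub_integral (hκ : IsProbabilityDensity κ)
    (hm : grainMoment μT Set.univ 1 ≠ ∞) (hf : Measurable f) (hC : ∀ x, ‖f x‖₊ ≤ C)
    (hN : ∀ᶠ i in L, HasPoissonLikeHits (N i) (M i) (germGrainLaw κ μT) Pr)
    (hs : Tendsto s L (𝓝[>] 0))
    (hM : Tendsto (fun i => M i * s i ^ Module.finrank ℝ E) L (𝓝 1)) :
    Tendsto (fun i => eLpNorm (fun ω =>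
      coveredIntegral volume f (N i) (grainCover (s i) Set.univ) ω
        - ∫ ω', coveredIntegral volume f (N i) (grainCover (s i) Set.univ) ω' ∂Pr) 1 Pr)
      L (𝓝 0) := by
  rw [ENNReal.tendsto_nhds_zero]
  intro ε hε
  have htail := ENNReal.Tendsto.const_mul (a := 2 * (C * 2 : ℝ≥0∞))
    (tendsto_grainMoment_compl_setOf_volume_le hm) (.inr (by finiteness))
  rw [mul_zero, ENNReal.tendsto_nhds_zero] at htail
  obtain ⟨K, hK⟩ := (htail (ε / 2) (ENNReal.half_pos hε.ne')).exists
  have hA := measurableSet_setOf_volume_le (α := E) K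
  have hdev := tendsto_eLpNorm_two_coveredIntegral_sub_integral hκ hA hm
    (grainMoment_two_setOf_volume_le_ne_top hm (ENNReal.natCast_ne_top K)) hf hC hN hs hM
  rw [ENNReal.tendsto_nhds_zero] at hdev
  filter_upwards [hN, hs.eventually self_mem_nhdsWithin, hM.eventually_le_const one_lt_two,
    hdev (ε / 2) (ENNReal.half_pos hε.ne')] with i hNi hsi hMi hdev_i
  refine (eLpNorm_one_sub_integral_le (hNi.integrable_coveredIntegral hκ hsi .univ hm hf hC)
    (hNi.integrable_coveredIntegral hκ hsi hA hm hf hC)).trans ?_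
  rw [← ENNReal.add_halves ε]
  refine add_le_add (le_trans ?_ hK) hdev_i
  rw [mul_assoc, mul_assoc]
  refine mul_le_mul' le_rfl
    ((hNi.eLpNorm_one_coveredIntegral_sub_le hκ hsi hA hm hf hC).trans ?_)
  gcongr
  exact (ENNReal.ofReal_le_ofReal hMi).trans_eq (by simp)

theorem convergesInLq_coveredIntegral (hκ : IsProbabilityDensity κ) {q : ℕ} (hq : q = 1 ∨ q = 2)
    (hm : grainMoment μT Set.univ q ≠ ∞) (hf : Measurable f) (hC : ∀ x, ‖f x‖₊ ≤ C)
    (hN : ∀ᶠ i in L, HasPoissonLikeHits (N i) (M i) (germGrainLaw κ μT) Pr)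
    (hs : Tendsto s L (𝓝[>] 0))
    (hM : Tendsto (fun i => M i * s i ^ Module.finrank ℝ E) L (𝓝 1)) :
    ConvergesInLq (fun i => coveredIntegral volume f (N i) (grainCover (s i) Set.univ)) L
      (∫ x, f x * (1 - Real.exp (-(κ x * (grainMoment μT Set.univ 1).toReal)))) q Pr := by
  have hq_one : 1 ≤ q := by omega
  have hm_one : grainMoment μT Set.univ 1 ≠ ∞ :=
    grainMoment_univ_ne_top_of_le (p := q) (by exact_mod_cast hq_one)
      (by simpa only [grainMoment, Measure.restrict_univ, ENNReal.rpow_natCast] using hm)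
  refine convergesInLq_of_tendsto_eLpNorm_sub_integral (by exact_mod_cast hq_one)
    (hN.mono fun i hNi => hNi.aestronglyMeasurable_coveredIntegral (s i) .univ hf) ?_
    (tendsto_integral_coveredIntegral hκ hm_one hf hC hN hs hM)
  rcases hq with rfl | rfl
  · simpa using tendsto_eLpNorm_one_coveredIntegral_sub_integral hκ hm_one hf hC hN hs hM
  · simpa using
      tendsto_eLpNorm_two_coveredIntegral_sub_integral hκ .univ hm_one hm hf hC hN hs hM

end CoveredIntegral

section EuclideanSpace

variable {d : ℕ} {κ : EuclideanSpace ℝ (Fin d) → ℝ}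
  {μT : Measure (Compacts (EuclideanSpace ℝ (Fin d)))} {f : EuclideanSpace ℝ (Fin d) → ℝ}

lemma IsAdmissibleDensity.isProbabilityDensity (hκ : IsAdmissibleDensity κ) :
    IsProbabilityDensity κ :=
  ⟨hκ.measurable, hκ.nonneg, hκ.lintegral_eq_one⟩

lemma setIntegral_grainUnion_eq_coveredIntegral {Ω : Type*}
    (N : Ω → Set (EuclideanSpace ℝ (Fin d) × Compacts (EuclideanSpace ℝ (Fin d)))) (l : ℝ) (ω : Ω) :
    ∫ x in grainUnion l (N ω), f x
      = coveredIntegral volume f N (grainCover (l ^ (-(1 : ℝ) / (d : ℝ))) Set.univ) ω := by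
  have hunion : grainUnion l (N ω)
      = {x | ω ∈ hitEvent N (grainCover (l ^ (-(1 : ℝ) / (d : ℝ))) Set.univ x)} := by
    ext x
    simp [grainUnion, hitEvent, grainCover, Set.Nonempty]
  rw [coveredIntegral, hunion]

lemma tendsto_rpow_neg_one_div_atTop (hd : 1 ≤ d) :
    Tendsto (fun l : ℝ => l ^ (-(1 : ℝ) / (d : ℝ))) atTop (𝓝[>] 0) := by
  have hd_pos : (0 : ℝ) < 1 / d := by positivity
  refine tendsto_nhdsWithin_iff.2 ⟨?_, (eventually_gt_atTop 0).mono fun l hl =>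
    Real.rpow_pos_of_pos hl _⟩
  simpa only [neg_div] using tendsto_rpow_neg_atTop hd_pos

lemma rpow_neg_one_div_pow (hd : 1 ≤ d) {l : ℝ} (hl : 0 < l) :
    (l ^ (-(1 : ℝ) / (d : ℝ))) ^ d = l⁻¹ := by
  have hd_ne : (d : ℝ) ≠ 0 := by positivity
  rw [← Real.rpow_natCast, ← Real.rpow_mul hl.le, div_mul_cancel₀ _ hd_ne, Real.rpow_neg_one]

variable {Ω : Type*} [MeasurableSpace Ω] {Pr : Measure Ω} [IsProbabilityMeasure Pr]
  [IsProbabilityMeasure μT]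

theorem convergesInLq_setIntegral_grainUnion (hd : 1 ≤ d) (hκ : IsProbabilityDensity κ) {q : ℕ}
    (hq : q = 1 ∨ q = 2) (hm : grainMoment μT Set.univ q ≠ ∞) (hf : Measurable f)
    (hfb : ∃ C : ℝ, ∀ x, |f x| ≤ C) {ι : Type*} {L : Filter ι}
    {N : ι → Ω → Set (EuclideanSpace ℝ (Fin d) × Compacts (EuclideanSpace ℝ (Fin d)))}
    {l M : ι → ℝ} (hN : ∀ᶠ i in L, HasPoissonLikeHits (N i) (M i) (germGrainLaw κ μT) Pr)
    (hl : Tendsto l L atTop) (hM : Tendsto (fun i => M i * (l i)⁻¹) L (𝓝 1)) :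
    ConvergesInLq (fun i ω => ∫ x in grainUnion (l i) (N i ω), f x) L
      (∫ x, f x * (1 - Real.exp (-(κ x * (grainMoment μT Set.univ 1).toReal)))) q Pr := by
  have : NeZero d := ⟨by omega⟩
  obtain ⟨C, hC⟩ := hfb
  have hC_nnnorm (x : EuclideanSpace ℝ (Fin d)) : ‖f x‖₊ ≤ C.toNNReal :=
    NNReal.le_toNNReal_of_coe_le (hC x)
  simp_rw [setIntegral_grainUnion_eq_coveredIntegral]
  refine convergesInLq_coveredIntegral hκ hq hm hf hC_nnnorm hN
    ((tendsto_rpow_neg_one_div_atTop hd).comp hl) (hM.congr' ?_)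
  filter_upwards [hl.eventually_gt_atTop 0] with i hi
  rw [finrank_euclideanSpace_fin, rpow_neg_one_div_pow hd hi]

end EuclideanSpace

end GermGrain

open GermGrain in
theorem theorem6p1_general (d : ℕ) (hd : 1 ≤ d)
    (κ : EuclideanSpace ℝ (Fin d) → ℝ) (hκ : IsProbabilityDensity κ)
    (μT : Measure (Compacts (EuclideanSpace ℝ (Fin d)))) [IsProbabilityMeasure μT]
    (q : ℕ) (hq : q = 1 ∨ q = 2) (hT : grainMoment μT Set.univ q ≠ ∞)
    (f : EuclideanSpace ℝ (Fin d) → ℝ) (hf : Measurable f) (hfb : ∃ C : ℝ, ∀ x, |f x| ≤ C) :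
    (∀ (Ω : Type*) [MeasurableSpace Ω] (Pr : Measure Ω) [IsProbabilityMeasure Pr]
      (P : ℝ → Ω → Set (EuclideanSpace ℝ (Fin d) × Compacts (EuclideanSpace ℝ (Fin d)))),
      (∀ l : ℝ, 0 < l → IsPoissonProcess (P l) (ENNReal.ofReal l • germGrainLaw κ μT) Pr) →
      ConvergesInLq (fun l ω => ∫ x in grainUnion l (P l ω), f x) atTop
        (∫ x, f x * (1 - Real.exp (-(κ x * (grainMoment μT Set.univ 1).toReal)))) q Pr) ∧
    (∀ (Ω : Type*) [MeasurableSpace Ω] (Pr : Measure Ω) [IsProbabilityMeasure Pr]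
      (X : ℕ → Ω → Set (EuclideanSpace ℝ (Fin d) × Compacts (EuclideanSpace ℝ (Fin d))))
      (l : ℕ → ℝ),
      (∀ n : ℕ, IsBinomialProcess (X n) n (germGrainLaw κ μT) Pr) →
      Tendsto (fun n : ℕ => l n / (n : ℝ)) atTop (𝓝 1) →
      ConvergesInLq (fun n ω => ∫ x in grainUnion (l n) (X n ω), f x) atTop
        (∫ x, f x * (1 - Real.exp (-(κ x * (grainMoment μT Set.univ 1).toReal)))) q Pr) := by
  have := hκ.isProbabilityMeasure_germGrainLaw (μT := μT)
  refine ⟨fun Ω _ Pr _ P hP => ?_, fun Ω _ Pr _ X l hX hl => ?_⟩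
  · refine convergesInLq_setIntegral_grainUnion hd hκ hq hT hf hfb
      ((eventually_gt_atTop 0).mono fun l hl => (hP l hl).hasPoissonLikeHits hl.le) tendsto_id
      (tendsto_const_nhds.congr' ?_)
    filter_upwards [eventually_ne_atTop 0] with l hl
    exact (mul_inv_cancel₀ hl).symm
  · have hl_atTop : Tendsto l atTop atTop := by
      refine (hl.pos_mul_atTop one_pos tendsto_natCast_atTop_atTop).congr' ?_
      filter_upwards [eventually_ne_atTop 0] with n hn
      exact div_mul_cancel₀ _ (Nat.cast_ne_zero.2 hn)
    refine convergesInLq_setIntegral_grainUnion hd hκ hq hT hf hfb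
      (Eventually.of_forall fun n => (hX n).hasPoissonLikeHits) hl_atTop ?_
    simpa [div_eq_mul_inv] using hl.inv₀ one_ne_zero

theorem theorem6p1 (d : ℕ) (hd : 1 ≤ d)
    (κ : EuclideanSpace ℝ (Fin d) → ℝ) (hκ : GermGrain.IsAdmissibleDensity κ)
    (μT : Measure (Compacts (EuclideanSpace ℝ (Fin d)))) [IsProbabilityMeasure μT]
    (q : ℕ) (hq : q = 1 ∨ q = 2) (p : ℝ) (hp : (q : ℝ) < p)
    (hT : ∫⁻ t : Compacts (EuclideanSpace ℝ (Fin d)),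
      volume (t : Set (EuclideanSpace ℝ (Fin d))) ^ p ∂μT < ∞)
    (f : EuclideanSpace ℝ (Fin d) → ℝ) (hf : Measurable f) (hfb : ∃ C : ℝ, ∀ x, |f x| ≤ C) :
    ∃ c : ℝ,
      (∀ (Ω : Type*) [MeasurableSpace Ω] (Pr : Measure Ω) [IsProbabilityMeasure Pr]
        (P : ℝ → Ω → Set (EuclideanSpace ℝ (Fin d) × Compacts (EuclideanSpace ℝ (Fin d)))),
        (∀ l : ℝ, 0 < l → GermGrain.IsPoissonProcess (P l)
          (ENNReal.ofReal l • (GermGrain.densityMeasure κ).prod μT) Pr) →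
        GermGrain.ConvergesInLq
          (fun (l : ℝ) ω => ∫ x in GermGrain.grainUnion l (P l ω), f x) atTop c q Pr) ∧
      (∀ (Ω : Type*) [MeasurableSpace Ω] (Pr : Measure Ω) [IsProbabilityMeasure Pr]
        (X : ℕ → Ω → Set (EuclideanSpace ℝ (Fin d) × Compacts (EuclideanSpace ℝ (Fin d))))
        (l : ℕ → ℝ),
        (∀ n : ℕ, GermGrain.IsBinomialProcess (X n) n
          ((GermGrain.densityMeasure κ).prod μT) Pr) →
        Tendsto (fun n : ℕ => l n / (n : ℝ)) atTop (𝓝 1) →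
        GermGrain.ConvergesInLq
          (fun (n : ℕ) ω => ∫ x in GermGrain.grainUnion (l n) (X n ω), f x) atTop c q Pr) :=
  ⟨_, theorem6p1_general d hd κ hκ.isProbabilityDensity μT q hq
    (GermGrain.grainMoment_univ_ne_top_of_le hp.le hT.ne) f hf hfb⟩
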